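/- **Theorem (Capelli identity for the symmetric pair $(U_{p,q}, U_p\times U_q)$, Case $\mathbb{C}$).** Let $p,q,n\ge 0$ be integers. *The pair $(\mathfrak g,\mathfrak k)$.* Let $\mathfrak g=\mathfrak{gl}_{p+q}(\mathbb C)$, let $\mathfrak p^+\subset\mathfrak g$ (resp. $\mathfrak p^-$) be the space of block matrices $\begin{pmatrix}0&G\\0&0\end{pmatrix}$ (resp. $\begin{pmatrix}0&0\\F&0\end{pmatrix}$) with $G\in \mathrm{Mat}_{p,q}(\mathbb C)$, $F\in\mathrm{Mat}_{q,p}(\mathbb C)$, and $\mathfrak p=\mathfrak p^+\oplus\mathfrak p^-$. Put $H^{(x)}_{ij}=E_{ij}$ $(1\le i,j\le p)$, $H^{(y)}_{ij}=E_{p+i,p+j}$ $(1\le i,j\le q)$, $G_{ij}=E_{i,p+j}\in\mathfrak p^+$ and $F_{ji}=E_{p+j,i}\in\mathfrak p^-$ $(1\le i\le p,\ 1\le j\le q)$. Let $\iota:S(\mathfrak p)\to U(\mathfrak g)$ be the linear map with $\iota(u_1u_2)=u_1u_2$ for $u_1\in S(\mathfrak p^+)=U(\mathfrak p^+)$, $u_2\in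 S(\mathfrak p^-)=U(\mathfrak p^-)$. For $k,d\ge 0$ let $\mathcal I^k_d$ be the set of $d$-element subsets of $\{1,\dots,k\}$; the elements of $S\in\mathcal I^k_d$ are written $s_1<\dots<s_d$. In the commutative algebra $S(\mathfrak p)$ put $$X_d^{\mathbb C}=\sum_{I\in\mathcal I^p_d,\;J\in\mathcal I^q_d}\det (G_{i_a,j_b})_{1\le a,b\le d}\cdot\det (F_{j_a,i_b})_{1\le a,b\le d}.$$ *The pair $(\mathfrak m,\mathfrak h)$.* Let $\mathfrak m=\mathfrak{gl}_n(\mathbb C)\oplus\mathfrak{gl}_n(\mathbb C)$, $E^{(x)}_{st}=(E_{st},0)$, $E^{(y)}_{st}=(0,E_{st})$, and let $H=\{(g,{}^tg^{-1}) : g\in GL_n(\mathbb C)\}$ (the complexification of $U_n$, with Lie algebra $\mathfrak h=\{(X,-{}^tX)\}$), acting on $U(\mathfrak m)$ by the adjoint action. With the column-determinant $\det(Z_{ab})=\sum_{\sigma\in\mathfrak S_d}\mathrm{sgn}(\sigma)Z_{\sigma(1)1}\cdots Z_{\sigma(d)d}$ put $$C_d^{\mathbb C}=(-1)^d\sum_{S,T\in\mathcal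 I^n_d}\det\bigl(E^{(x)}_{s_a,t_b}+(d-b-\tfrac p2)\delta_{s_a,t_b}\bigr)_{1\le a,b\le d}\;\det\bigl(E^{(y)}_{s_a,t_b}+(d-b-\tfrac q2)\delta_{s_a,t_b}\bigr)_{1\le a,b\le d}\in U(\mathfrak m).$$ *The Weil representation.* Let $\mathbb C[V]$ be the algebra of polynomial functions on $V=\mathrm{Mat}_{n,p}(\mathbb C)\oplus\mathrm{Mat}_{n,q}(\mathbb C)$ with coordinates $x_{si}$, $y_{sj}$. The Weil representation $\omega$ is given on $\mathfrak g$ and on $\mathfrak m$ by the following operators on $\mathbb C[V]$, and is extended to $U(\mathfrak g)$ and $U(\mathfrak m)$: $$\omega(H^{(x)}_{ij})=\sum_s x_{si}\tfrac{\partial}{\partial x_{sj}}+\tfrac n2\delta_{ij},\qquad \omega(H^{(y)}_{ij})=-\sum_s y_{sj}\tfrac{\partial}{\partial y_{si}}-\tfrac n2\delta_{ij},$$ $$\omega(G_{ij})=\sqrt{-1}\sum_s x_{si}y_{sj},\qquad \omega(F_{ji})=\sqrt{-1}\sum_s\tfrac{\partial}{\partial x_{si}}\tfrac{\partial}{\partial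 y_{sj}},$$ $$\omega(E^{(x)}_{st})=\sum_{i=1}^p x_{si}\tfrac{\partial}{\partial x_{ti}}+\tfrac p2\delta_{st},\qquad \omega(E^{(y)}_{st})=\sum_{j=1}^q y_{sj}\tfrac{\partial}{\partial y_{tj}}+\tfrac q2\delta_{st}.$$ Then: 1. for $1\le d\le\min(p,q,n)$ one has $\omega(\iota(X_d^{\mathbb C}))=\omega(C_d^{\mathbb C})$; 2. for $1\le d\le n$ the element $C_d^{\mathbb C}$ lies in $U(\mathfrak m)^H$ (in particular it is $U_n$-invariant); 3. for $n<d\le\min(p,q)$ the identity is trivial: $C_d^{\mathbb C}=0$ and $\omega(\iota(X_d^{\mathbb C}))=0$. -/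

import Mathlib

open scoped TensorProduct

-- The commutator bracket on an associative algebra (matrices, endomorphisms, `U(𝔤)`).
attribute [local instance] LieRing.ofAssociativeRing

noncomputable section

namespace CapelliC

/-! ### Generalities -/

/-- The column-determinant `∑_σ sgn(σ) Z_{σ(1)1} Z_{σ(2)2} ⋯ Z_{σ(d)d}` of a square matrix with
entries in a possibly non-commutative ring. -/
def colDet {A : Type*} [Ring A] {d : ℕ} (Z : Matrix (Fin d) (Fin d) A) : A :=
  ∑ σ : Equiv.Perm (Fin d), (Equiv.Perm.sign σ : ℤ) • (List.ofFn fun b => Z (σ b) b).prod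

/-- The set of `d`-element subsets of `{1, …, k}` (here `{0, …, k-1}`). -/
abbrev Sub (k d : ℕ) : Type := {I : Finset (Fin k) // I.card = d}

/-- The elements `s_1 < s_2 < ⋯ < s_d` of a `d`-element subset, in increasing order. -/
def Sub.el {k d : ℕ} (I : Sub k d) : Fin d → Fin k := I.1.orderEmbOfFin I.2

/-- A linear map with pairwise commuting values in an algebra extends to an algebra homomorphism
from the symmetric algebra. -/
def symLift {M A : Type*} [AddCommGroup M] [Module ℂ M] [Ring A] [Algebra ℂ A]
    (f : M →ₗ[ℂ] A) (h : ∀ u v, f u * f v = f v * f u) : SymmetricAlgebra ℂ M →ₐ[ℂ] A :=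
  RingCon.liftₐ (TensorAlgebra.symRingCon ℂ M) (TensorAlgebra.lift ℂ f) <| by
    refine RingCon.ringConGen_le.2 ?_
    intro x y hxy
    induction hxy with
    | mul_comm x y =>
      rw [RingCon.ker_apply]
      simpa using h x y

theorem symLift_ι {M A : Type*} [AddCommGroup M] [Module ℂ M] [Ring A] [Algebra ℂ A]
    (f : M →ₗ[ℂ] A) (h : ∀ u v, f u * f v = f v * f u) (m : M) :
    symLift f h (SymmetricAlgebra.ι ℂ M m) = f m := by
  change TensorAlgebra.lift ℂ f (TensorAlgebra.ι ℂ m) = f m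
  simp

/-- Operators satisfying the relations of the matrix units of `𝔤𝔩` define a representation. -/
def glLieHom {α A : Type*} [Fintype α] [DecidableEq α] [Ring A] [Algebra ℂ A] (E : α → α → A)
    (hE : ∀ a b c e, E a b * E c e - E c e * E a b =
      (if b = c then E a e else 0) - (if a = e then E c b else 0)) :
    Matrix α α ℂ →ₗ⁅ℂ⁆ A where
  toFun Z := ∑ a, ∑ b, Z a b • E a b
  map_add' Z W := by simp [add_smul, Finset.sum_add_distrib]
  map_smul' r Z := by simp [mul_smul, Finset.smul_sum]
  map_lie' := by
    intro Z W
    have h0 : ∀ F : α → α → α → A, (∑ a, ∑ b, ∑ c, F a b c) = ∑ c, ∑ a, ∑ b, F a b c := by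
      intro F
      calc (∑ a, ∑ b, ∑ c, F a b c) = ∑ a, ∑ c, ∑ b, F a b c :=
            Finset.sum_congr rfl fun _ _ => Finset.sum_comm
        _ = _ := Finset.sum_comm
    have h1 : ∀ F : α → α → α → α → A,
        (∑ a, ∑ b, ∑ c, ∑ e, F a b c e) = ∑ c, ∑ e, ∑ a, ∑ b, F a b c e := by
      intro F
      rw [h0 fun a b c => ∑ e, F a b c e]
      exact Finset.sum_congr rfl fun c _ => h0 fun a b e => F a b c e
    have key : ∀ U : Matrix α α ℂ, ∀ V : Matrix α α ℂ,
        (∑ a, ∑ e, (U * V) a e • E a e) =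
          ∑ a, ∑ b, ∑ c, ∑ e, (U a b * V c e) • (if b = c then E a e else 0) := by
      intro U V
      refine Finset.sum_congr rfl fun a _ => ?_
      simp only [Matrix.mul_apply, Finset.sum_smul, smul_ite, smul_zero]
      rw [Finset.sum_comm]
      refine Finset.sum_congr rfl fun b _ => ?_
      rw [Finset.sum_comm]
      simp
    have key2 : (∑ a, ∑ e, (W * Z) a e • E a e) =
          ∑ a, ∑ b, ∑ c, ∑ e, (Z a b * W c e) • (if a = e then E c b else 0) := by
      rw [key W Z]
      rw [h1]
      refine Finset.sum_congr rfl fun a _ => Finset.sum_congr rfl fun b _ =>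
        Finset.sum_congr rfl fun c _ => Finset.sum_congr rfl fun e _ => ?_
      simp only [mul_comm, eq_comm]
    have hL : ∀ U V : Matrix α α ℂ,
        (∑ a, ∑ b, U a b • E a b) * (∑ c, ∑ e, V c e • E c e) =
          ∑ a, ∑ b, ∑ c, ∑ e, (U a b * V c e) • (E a b * E c e) := by
      intro U V
      simp only [Finset.sum_mul, Finset.mul_sum, smul_mul_smul_comm]
      exact h1 fun c e a b => (U a b * V c e) • (E a b * E c e)
    have hR : (∑ c, ∑ e, W c e • E c e) * (∑ a, ∑ b, Z a b • E a b) =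
          ∑ a, ∑ b, ∑ c, ∑ e, (Z a b * W c e) • (E c e * E a b) := by
      simp only [Finset.sum_mul, Finset.mul_sum, smul_mul_smul_comm, mul_comm]
    simp only [LieRing.of_associative_ring_bracket, Matrix.sub_apply, sub_smul,
      Finset.sum_sub_distrib]
    rw [hL, hR, key, key2]
    simp only [← Finset.sum_sub_distrib, ← smul_sub, hE]

theorem glLieHom_single {α A : Type*} [Fintype α] [DecidableEq α] [Ring A] [Algebra ℂ A]
    (E : α → α → A) (hE) (a b : α) : glLieHom E hE (Matrix.single a b 1) = E a b := by
  change (∑ c, ∑ e, Matrix.single a b (1 : ℂ) c e • E c e) = E a b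
  rw [Finset.sum_eq_single a, Finset.sum_eq_single b] <;>
    simp +contextual [Matrix.single_apply, eq_comm]

/-- Bilinear expressions in canonical operators satisfy the relations of the matrix units. -/
theorem oscillator {α κ A : Type*} [Fintype κ] [DecidableEq α] [DecidableEq κ] [Ring A]
    [Algebra ℂ A] (u v : κ → α → A) (r : ℂ)
    (huu : ∀ s a t b, u s a * u t b = u t b * u s a)
    (hvv : ∀ s a t b, v s a * v t b = v t b * v s a)
    (hvu : ∀ s a t b, v s a * u t b = u t b * v s a + if s = t ∧ a = b then 1 else 0)
    (E : α → α → A) (hE : ∀ a b, E a b = ∑ s, u s a * v s b + if a = b then r • 1 else 0)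
    (a b c e : α) :
    E a b * E c e - E c e * E a b =
      (if b = c then E a e else 0) - (if a = e then E c b else 0) := by
  have h1 : ∀ s t, (u s a * v s b) * (u t c * v t e) - (u t c * v t e) * (u s a * v s b) =
      if s = t then ((if b = c then u s a * v s e else 0) -
        (if a = e then u s c * v s b else 0)) else 0 := by
    intro s t
    have e1 : (u s a * v s b) * (u t c * v t e) = u s a * (u t c * v s b) * v t e +
        u s a * (if s = t ∧ b = c then 1 else 0) * v t e := by
      rw [mul_assoc, ← mul_assoc (v s b), hvu]; noncomm_ring
    have e2 : (u t c * v t e) * (u s a * v s b) = u t c * (u s a * v t e) * v s b +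
        u t c * (if t = s ∧ e = a then 1 else 0) * v s b := by
      rw [mul_assoc, ← mul_assoc (v t e), hvu]; noncomm_ring
    have e3 : u s a * (u t c * v s b) * v t e = u t c * (u s a * v t e) * v s b := by
      rw [← mul_assoc, ← mul_assoc, huu s a t c, mul_assoc, mul_assoc (u t c * u s a), hvv]
    rw [e1, e2, e3, add_sub_add_left_eq_sub]
    by_cases hst : s = t
    · subst hst
      by_cases hbc : b = c <;> by_cases hae : a = e <;>
        simp [hbc, hae, eq_comm]
    · simp [hst, Ne.symm hst]
  have h2 : (∑ s, u s a * v s b) * (∑ t, u t c * v t e) -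
      (∑ t, u t c * v t e) * (∑ s, u s a * v s b) =
      (if b = c then ∑ s, u s a * v s e else 0) -
        (if a = e then ∑ s, u s c * v s b else 0) := by
    rw [Finset.sum_mul_sum, Finset.sum_mul_sum, Finset.sum_comm (s := Finset.univ)
      (f := fun i j => u i c * v i e * (u j a * v j b)), ← Finset.sum_sub_distrib]
    simp only [← Finset.sum_sub_distrib, h1]
    simp only [Finset.sum_ite_eq, Finset.mem_univ, if_true, Finset.sum_sub_distrib]
    split_ifs <;> simp
  have h3 : ∀ (P Q : A) (x y : ℂ), (P + x • 1) * (Q + y • 1) - (Q + y • 1) * (P + x • 1) =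
      P * Q - Q * P := by
    intro P Q x y
    have c1 : (x • (1 : A)) * Q = Q * (x • 1) := by simp
    have c2 : (y • (1 : A)) * P = P * (y • 1) := by simp
    have c3 : (y • (1 : A)) * (x • 1) = (x • 1) * (y • 1) := by simp [smul_smul, mul_comm]
    rw [add_mul, mul_add, mul_add, add_mul, mul_add, mul_add, c1, c2, c3]
    abel
  have h4 : ∀ a b, E a b = ∑ s, u s a * v s b + (if a = b then r else 0) • (1 : A) := by
    intro a b; rw [hE]; split_ifs <;> simp
  rw [h4 a b, h4 c e, h3, h2, h4 a e, h4 c b]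
  by_cases hbc : b = c <;> by_cases hae : a = e
  · subst hbc hae; simp
  · subst hbc; simp [hae]
  · subst hae; simp [hbc, Ne.symm hbc]
  · simp [hbc, hae]

/-! ### The Lie algebra `𝔤 = 𝔤𝔩_{p+q}`, the space `𝔭 = 𝔭⁺ ⊕ 𝔭⁻` and the map `ι` -/

/-- `𝔤 = 𝔤𝔩_{p+q}(ℂ)`, the complexified Lie algebra of `U_{p,q}`, in block form. -/
abbrev 𝔤 (p q : ℕ) : Type := Matrix (Fin p ⊕ Fin q) (Fin p ⊕ Fin q) ℂ

/-- `𝔭`: the matrices `(0 G; F 0)`. -/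
def 𝔭 (p q : ℕ) : Submodule ℂ (𝔤 p q) where
  carrier := {Z | Z.toBlocks₁₁ = 0 ∧ Z.toBlocks₂₂ = 0}
  zero_mem' := ⟨rfl, rfl⟩
  add_mem' := by
    rintro Z W ⟨h1, h2⟩ ⟨h3, h4⟩
    exact ⟨(congrArg₂ (· + ·) h1 h3).trans (add_zero 0),
      (congrArg₂ (· + ·) h2 h4).trans (add_zero 0)⟩
  smul_mem' := by
    rintro r Z ⟨h1, h2⟩
    exact ⟨(congrArg (r • ·) h1).trans (smul_zero r), (congrArg (r • ·) h2).trans (smul_zero r)⟩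

/-- `𝔭⁺`: the matrices `(0 G; 0 0)`. -/
def 𝔭plus (p q : ℕ) : Submodule ℂ (𝔤 p q) where
  carrier := {Z | ∃ G : Matrix (Fin p) (Fin q) ℂ, Z = Matrix.fromBlocks 0 G 0 0}
  zero_mem' := ⟨0, by simp⟩
  add_mem' := by
    rintro _ _ ⟨G, rfl⟩ ⟨G', rfl⟩
    exact ⟨G + G', by simp [Matrix.fromBlocks_add]⟩
  smul_mem' := by
    rintro r _ ⟨G, rfl⟩
    exact ⟨r • G, by simp [Matrix.fromBlocks_smul]⟩

/-- `𝔭⁻`: the matrices `(0 0; F 0)`. -/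
def 𝔭minus (p q : ℕ) : Submodule ℂ (𝔤 p q) where
  carrier := {Z | ∃ F : Matrix (Fin q) (Fin p) ℂ, Z = Matrix.fromBlocks 0 0 F 0}
  zero_mem' := ⟨0, by simp⟩
  add_mem' := by
    rintro _ _ ⟨F, rfl⟩ ⟨F', rfl⟩
    exact ⟨F + F', by simp [Matrix.fromBlocks_add]⟩
  smul_mem' := by
    rintro r _ ⟨F, rfl⟩
    exact ⟨r • F, by simp [Matrix.fromBlocks_smul]⟩

/-- The projection `𝔭 → 𝔭⁺`. -/
def projPlus (p q : ℕ) : 𝔭 p q →ₗ[ℂ] 𝔭plus p q where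
  toFun Z := ⟨Matrix.fromBlocks 0 Z.1.toBlocks₁₂ 0 0, _, rfl⟩
  map_add' Z W := by
    ext (i | i) (j | j) <;> simp [Matrix.toBlocks₁₂]
  map_smul' r Z := by
    ext (i | i) (j | j) <;> simp [Matrix.toBlocks₁₂]

/-- The projection `𝔭 → 𝔭⁻`. -/
def projMinus (p q : ℕ) : 𝔭 p q →ₗ[ℂ] 𝔭minus p q where
  toFun Z := ⟨Matrix.fromBlocks 0 0 Z.1.toBlocks₂₁ 0, _, rfl⟩
  map_add' Z W := by
    ext (i | i) (j | j) <;> simp [Matrix.toBlocks₂₁]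
  map_smul' r Z := by
    ext (i | i) (j | j) <;> simp [Matrix.toBlocks₂₁]

/-- The enveloping algebra `U(𝔤)`. -/
abbrev Ug (p q : ℕ) : Type := UniversalEnvelopingAlgebra ℂ (𝔤 p q)

/-- The homomorphism `S(𝔭⁺) = U(𝔭⁺) → U(𝔤)` (`𝔭⁺` is an abelian Lie algebra). -/
def symPlus (p q : ℕ) : SymmetricAlgebra ℂ (𝔭plus p q) →ₐ[ℂ] Ug p q :=
  symLift ((UniversalEnvelopingAlgebra.ι ℂ : 𝔤 p q →ₗ⁅ℂ⁆ Ug p q).toLinearMap ∘ₗ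
      (𝔭plus p q).subtype) <| by
    rintro ⟨_, G, rfl⟩ ⟨_, G', rfl⟩
    rw [← sub_eq_zero, ← LieRing.of_associative_ring_bracket]
    change ⁅UniversalEnvelopingAlgebra.ι ℂ (Matrix.fromBlocks 0 G 0 0 : 𝔤 p q),
      UniversalEnvelopingAlgebra.ι ℂ (Matrix.fromBlocks 0 G' 0 0 : 𝔤 p q)⁆ = 0
    rw [← LieHom.map_lie, LieRing.of_associative_ring_bracket]
    simp [Matrix.fromBlocks_multiply, -UniversalEnvelopingAlgebra.ι_apply]

/-- The homomorphism `S(𝔭⁻) = U(𝔭⁻) → U(𝔤)` (`𝔭⁻` is an abelian Lie algebra). -/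
def symMinus (p q : ℕ) : SymmetricAlgebra ℂ (𝔭minus p q) →ₐ[ℂ] Ug p q :=
  symLift ((UniversalEnvelopingAlgebra.ι ℂ : 𝔤 p q →ₗ⁅ℂ⁆ Ug p q).toLinearMap ∘ₗ
      (𝔭minus p q).subtype) <| by
    rintro ⟨_, F, rfl⟩ ⟨_, F', rfl⟩
    rw [← sub_eq_zero, ← LieRing.of_associative_ring_bracket]
    change ⁅UniversalEnvelopingAlgebra.ι ℂ (Matrix.fromBlocks 0 0 F 0 : 𝔤 p q),
      UniversalEnvelopingAlgebra.ι ℂ (Matrix.fromBlocks 0 0 F' 0 : 𝔤 p q)⁆ = 0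
    rw [← LieHom.map_lie, LieRing.of_associative_ring_bracket]
    simp [Matrix.fromBlocks_multiply, -UniversalEnvelopingAlgebra.ι_apply]

/-- The algebra homomorphism `S(𝔭) → S(𝔭⁺) ⊗ S(𝔭⁻)` (an isomorphism) induced by `𝔭 = 𝔭⁺ ⊕ 𝔭⁻`. -/
def splitS (p q : ℕ) : SymmetricAlgebra ℂ (𝔭 p q) →ₐ[ℂ]
    SymmetricAlgebra ℂ (𝔭plus p q) ⊗[ℂ] SymmetricAlgebra ℂ (𝔭minus p q) :=
  SymmetricAlgebra.lift
    (Algebra.TensorProduct.includeLeft.toLinearMap ∘ₗ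
        SymmetricAlgebra.ι ℂ (𝔭plus p q) ∘ₗ projPlus p q +
      Algebra.TensorProduct.includeRight.toLinearMap ∘ₗ
        SymmetricAlgebra.ι ℂ (𝔭minus p q) ∘ₗ projMinus p q)

/-- The pseudo-symmetrization map `ι : S(𝔭) → U(𝔤)`, `u₁ u₂ ↦ u₁ u₂` for `u₁ ∈ S(𝔭⁺)` and
`u₂ ∈ S(𝔭⁻)`. It is linear, not multiplicative. -/
def pseudoSym (p q : ℕ) : SymmetricAlgebra ℂ (𝔭 p q) →ₗ[ℂ] Ug p q :=
  LinearMap.mul' ℂ (Ug p q) ∘ₗ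
    TensorProduct.map (symPlus p q).toLinearMap (symMinus p q).toLinearMap ∘ₗ
      (splitS p q).toLinearMap

/-- `G_{ij} = E_{i,p+j} ∈ 𝔭`, for `1 ≤ i ≤ p`, `1 ≤ j ≤ q`. -/
def Gel (p q : ℕ) (i : Fin p) (j : Fin q) : 𝔭 p q :=
  ⟨Matrix.single (Sum.inl i) (Sum.inr j) 1, by
    constructor <;> ext a b <;> simp [Matrix.toBlocks₁₁, Matrix.toBlocks₂₂]⟩

/-- `F_{ij} = E_{p+i,j} ∈ 𝔭`, for `1 ≤ i ≤ q`, `1 ≤ j ≤ p`. -/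
def Fel (p q : ℕ) (i : Fin q) (j : Fin p) : 𝔭 p q :=
  ⟨Matrix.single (Sum.inr i) (Sum.inl j) 1, by
    constructor <;> ext a b <;> simp [Matrix.toBlocks₁₁, Matrix.toBlocks₂₂]⟩

/-- The `p × q` matrix `(G_{ij})` over the commutative ring `S(𝔭)`. -/
def Gmat (p q : ℕ) : Matrix (Fin p) (Fin q) (SymmetricAlgebra ℂ (𝔭 p q)) :=
  Matrix.of fun i j => SymmetricAlgebra.ι ℂ (𝔭 p q) (Gel p q i j)

/-- The `q × p` matrix `(F_{ij})` over the commutative ring `S(𝔭)`. -/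
def Fmat (p q : ℕ) : Matrix (Fin q) (Fin p) (SymmetricAlgebra ℂ (𝔭 p q)) :=
  Matrix.of fun i j => SymmetricAlgebra.ι ℂ (𝔭 p q) (Fel p q i j)

/-- `X_d = ∑_{I,J} det G_{IJ} · det F_{JI} ∈ S(𝔭)`. -/
def Xgen (p q d : ℕ) : SymmetricAlgebra ℂ (𝔭 p q) :=
  ∑ I : Sub p d, ∑ J : Sub q d,
    ((Gmat p q).submatrix I.el J.el).det * ((Fmat p q).submatrix J.el I.el).det

/-! ### The Lie algebra `𝔪 = 𝔤𝔩_n ⊕ 𝔤𝔩_n`, the group `H` and the Capelli elements -/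

/-- `𝔪 = 𝔤𝔩_n ⊕ 𝔤𝔩_n`, the complexified Lie algebra of `U_n × U_n`. -/
abbrev 𝔪 (n : ℕ) : Type := Matrix (Fin n) (Fin n) ℂ × Matrix (Fin n) (Fin n) ℂ

/-- The enveloping algebra `U(𝔪)`. -/
abbrev Um (n : ℕ) : Type := UniversalEnvelopingAlgebra ℂ (𝔪 n)

/-- `E^{(x)}_{st} = (E_{st}, 0)`, as an element of `U(𝔪)`. -/
def Ex (n : ℕ) (s t : Fin n) : Um n :=
  UniversalEnvelopingAlgebra.ι ℂ ((Matrix.single s t 1, 0) : 𝔪 n)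

/-- `E^{(y)}_{st} = (0, E_{st})`, as an element of `U(𝔪)`. -/
def Ey (n : ℕ) (s t : Fin n) : Um n :=
  UniversalEnvelopingAlgebra.ι ℂ ((0, Matrix.single s t 1) : 𝔪 n)

/-- The shifted minor `det( E_{s_a,t_b} + (d - b - c) δ_{s_a,t_b} )_{a,b}` (column-determinant);
the column index `b = 1, …, d` is `(b : ℕ) + 1` for `b : Fin d`. -/
def shiftedMinor {n d : ℕ} (E : Fin n → Fin n → Um n) (c : ℂ) (S T : Sub n d) : Um n :=
  colDet (Matrix.of fun a b : Fin d =>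
    E (S.el a) (T.el b) +
      if S.el a = T.el b then algebraMap ℂ (Um n) ((d : ℂ) - ((b : ℕ) + 1 : ℂ) - c) else 0)

/-- The Capelli element `C_d ∈ U(𝔪)`. -/
def Cap (p q n d : ℕ) : Um n :=
  (-1) ^ d * ∑ S : Sub n d, ∑ T : Sub n d,
    shiftedMinor (Ex n) ((p : ℂ) / 2) S T * shiftedMinor (Ey n) ((q : ℂ) / 2) S T

/-- The adjoint action on `𝔪` of the element `(g, ᵗg⁻¹)` of the subgroup `H ≃ GL_n(ℂ)` of
`GL_n(ℂ) × GL_n(ℂ)` with Lie algebra `𝔥 = {(X, -ᵗX)}`: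
`(Z, W) ↦ (g Z g⁻¹, ᵗg⁻¹ W ᵗg)`. -/
def AdH {n : ℕ} (g : Matrix.GeneralLinearGroup (Fin n) ℂ) : 𝔪 n →ₗ⁅ℂ⁆ 𝔪 n where
  toFun Z := (g.1 * Z.1 * g⁻¹.1, (g⁻¹.1).transpose * Z.2 * (g.1).transpose)
  map_add' Z W := by simp [mul_add, add_mul]
  map_smul' r Z := by simp
  map_lie' := by
    intro Z W
    have h1 : g⁻¹.1 * g.1 = 1 := g.inv_mul
    have h2 : g.1.transpose * g⁻¹.1.transpose = 1 := by
      rw [← Matrix.transpose_mul, h1, Matrix.transpose_one]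
    have key : ∀ a b : Matrix (Fin n) (Fin n) ℂ, b * a = 1 → ∀ z w : Matrix (Fin n) (Fin n) ℂ,
        a * (z * w - w * z) * b = (a * z * b) * (a * w * b) - (a * w * b) * (a * z * b) := by
      intro a b h z w
      have h3 : ∀ z w, (a * z * b) * (a * w * b) = a * (z * w) * b := by
        intro z w
        calc (a * z * b) * (a * w * b) = a * z * (b * a) * w * b := by noncomm_ring
          _ = a * (z * w) * b := by rw [h]; noncomm_ring
      rw [h3, h3]; noncomm_ring
    exact Prod.ext (key _ _ h1 _ _) (key _ _ h2 _ _)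

/-- The subspace `U(𝔪)^H` of invariants under the adjoint action of `H` on `U(𝔪)`. -/
def UmH (n : ℕ) : Submodule ℂ (Um n) :=
  ⨅ g : Matrix.GeneralLinearGroup (Fin n) ℂ,
    LinearMap.eqLocus
      (UniversalEnvelopingAlgebra.lift ℂ
        ((UniversalEnvelopingAlgebra.ι ℂ : 𝔪 n →ₗ⁅ℂ⁆ Um n).comp (AdH g))).toLinearMap
      LinearMap.id

/-! ### The Weil representation on `ℂ[V]`, `V = Mat_{n,p}(ℂ) ⊕ Mat_{n,q}(ℂ)` -/

/-- Polynomial functions on `V`: the coordinates are `x_{si}` (`Sum.inl (s, i)`) and `y_{sj}`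
(`Sum.inr (s, j)`). -/
abbrev Pol (p q n : ℕ) : Type := MvPolynomial ((Fin n × Fin p) ⊕ (Fin n × Fin q)) ℂ

section operators

variable (p q n : ℕ)

/-- Multiplication by `x_{si}`. -/
def xop (s : Fin n) (i : Fin p) : Module.End ℂ (Pol p q n) :=
  LinearMap.mulLeft ℂ (MvPolynomial.X (Sum.inl (s, i)))

/-- Multiplication by `y_{sj}`. -/
def yop (s : Fin n) (j : Fin q) : Module.End ℂ (Pol p q n) :=
  LinearMap.mulLeft ℂ (MvPolynomial.X (Sum.inr (s, j)))

/-- The partial derivative `∂/∂x_{si}`. -/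
def dxop (s : Fin n) (i : Fin p) : Module.End ℂ (Pol p q n) :=
  (MvPolynomial.pderiv (Sum.inl (s, i))).toLinearMap

/-- The partial derivative `∂/∂y_{sj}`. -/
def dyop (s : Fin n) (j : Fin q) : Module.End ℂ (Pol p q n) :=
  (MvPolynomial.pderiv (Sum.inr (s, j))).toLinearMap

/-- The operators `ω(E_{ab})` for the matrix units of `𝔤 = 𝔤𝔩_{p+q}`; the four cases are
`ω(H^{(x)}_{ij})`, `ω(G_{ij})`, `ω(F_{ji})` and `ω(H^{(y)}_{ij})`. -/
def omegaUnit : Fin p ⊕ Fin q → Fin p ⊕ Fin q → Module.End ℂ (Pol p q n)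
  | Sum.inl i, Sum.inl j =>
      ∑ s, xop p q n s i * dxop p q n s j + if i = j then ((n : ℂ) / 2) • 1 else 0
  | Sum.inl i, Sum.inr j => Complex.I • ∑ s, xop p q n s i * yop p q n s j
  | Sum.inr j, Sum.inl i => Complex.I • ∑ s, dxop p q n s i * dyop p q n s j
  | Sum.inr i, Sum.inr j =>
      -∑ s, yop p q n s j * dyop p q n s i - if i = j then ((n : ℂ) / 2) • 1 else 0

/-- The operator `ω(E^{(x)}_{st})`. -/
def omegaEx (s t : Fin n) : Module.End ℂ (Pol p q n) :=
  ∑ i, xop p q n s i * dxop p q n t i + if s = t then ((p : ℂ) / 2) • 1 else 0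

/-- The operator `ω(E^{(y)}_{st})`. -/
def omegaEy (s t : Fin n) : Module.End ℂ (Pol p q n) :=
  ∑ j, yop p q n s j * dyop p q n t j + if s = t then ((q : ℂ) / 2) • 1 else 0

theorem mulX_comm {σ : Type*} (a b : σ) :
    LinearMap.mulLeft ℂ (MvPolynomial.X a : MvPolynomial σ ℂ) *
      LinearMap.mulLeft ℂ (MvPolynomial.X b) =
    LinearMap.mulLeft ℂ (MvPolynomial.X b) * LinearMap.mulLeft ℂ (MvPolynomial.X a) := by
  refine LinearMap.ext fun f => ?_
  simp only [Module.End.mul_apply, LinearMap.mulLeft_apply]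
  ring

theorem pderiv_comm' {σ : Type*} (a b : σ) :
    ((MvPolynomial.pderiv a).toLinearMap * (MvPolynomial.pderiv b).toLinearMap :
      Module.End ℂ (MvPolynomial σ ℂ)) =
    (MvPolynomial.pderiv b).toLinearMap * (MvPolynomial.pderiv a).toLinearMap := by
  classical
  have h : ⁅(MvPolynomial.pderiv a : Derivation ℂ (MvPolynomial σ ℂ) (MvPolynomial σ ℂ)),
      (MvPolynomial.pderiv b : Derivation ℂ (MvPolynomial σ ℂ) (MvPolynomial σ ℂ))⁆ = 0 := by
    refine MvPolynomial.derivation_ext fun i => ?_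
    simp [Derivation.commutator_apply, MvPolynomial.pderiv_X, Pi.single_apply, apply_ite]
  refine LinearMap.ext fun f => ?_
  have := congrArg (fun D => D f) h
  simpa [Derivation.commutator_apply, sub_eq_zero] using this

theorem pderiv_mulX {σ : Type*} [DecidableEq σ] (a b : σ) :
    ((MvPolynomial.pderiv a).toLinearMap * LinearMap.mulLeft ℂ (MvPolynomial.X b) :
      Module.End ℂ (MvPolynomial σ ℂ)) =
    LinearMap.mulLeft ℂ (MvPolynomial.X b) * (MvPolynomial.pderiv a).toLinearMap +
      if a = b then 1 else 0 := by
  refine LinearMap.ext fun f => ?_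
  by_cases h : a = b
  · subst h
    simp [Derivation.leibniz]
  · simp [Derivation.leibniz, MvPolynomial.pderiv_X, h, Ne.symm h]

theorem omegaUnit_rel (a b c e : Fin p ⊕ Fin q) :
    omegaUnit p q n a b * omegaUnit p q n c e - omegaUnit p q n c e * omegaUnit p q n a b =
      (if b = c then omegaUnit p q n a e else 0) -
        (if a = e then omegaUnit p q n c b else 0) := by
  have hII : ∀ P : Module.End ℂ (Pol p q n), Complex.I • Complex.I • P = -P := by
    intro P; rw [smul_smul, Complex.I_mul_I, neg_one_smul]
  have hIm : ∀ P Q : Module.End ℂ (Pol p q n), (Complex.I • P) * (Complex.I • Q) = -(P * Q) := by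
    intro P Q; rw [smul_mul_assoc, mul_smul_comm, hII]
  refine oscillator
    (u := fun s => Sum.elim (fun i => xop p q n s i) (fun j => Complex.I • dyop p q n s j))
    (v := fun s => Sum.elim (fun i => dxop p q n s i) (fun j => Complex.I • yop p q n s j))
    ((n : ℂ) / 2) ?_ ?_ ?_ _ ?_ a b c e
  · rintro s (i | i) t (j | j) <;>
      simp [xop, dyop, mulX_comm, pderiv_comm', pderiv_mulX]
  · rintro s (i | i) t (j | j) <;>
      simp [yop, dxop, mulX_comm, pderiv_comm', pderiv_mulX]
  · rintro s (i | i) t (j | j) <;>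
      simp [xop, yop, dxop, dyop, mulX_comm, pderiv_comm', pderiv_mulX, hII]
    split_ifs <;> simp_all
  · rintro (i | i) (j | j)
    · simp [omegaUnit]
    · simp [omegaUnit, Finset.smul_sum]
    · simp [omegaUnit, Finset.smul_sum, dxop, dyop, pderiv_comm']
    · simp only [omegaUnit, Sum.elim_inr, dyop, yop, hIm,
        pderiv_mulX, neg_add, Finset.sum_add_distrib,
        Finset.sum_neg_distrib, Sum.inr.injEq, Prod.mk.injEq, true_and]
      by_cases h : i = j
      · subst h
        simp only [if_true, Finset.sum_const, Finset.card_univ, Fintype.card_fin]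
        rw [← Nat.cast_smul_eq_nsmul ℂ]
        module
      · simp [h]

theorem omegaEx_rel (a b c e : Fin n) :
    omegaEx p q n a b * omegaEx p q n c e - omegaEx p q n c e * omegaEx p q n a b =
      (if b = c then omegaEx p q n a e else 0) - (if a = e then omegaEx p q n c b else 0) := by
  refine oscillator (u := fun i s => xop p q n s i) (v := fun i s => dxop p q n s i)
    ((p : ℂ) / 2) ?_ ?_ ?_ _ (fun a b => rfl) a b c e
  · intro s i t j; exact mulX_comm _ _
  · intro s i t j; exact pderiv_comm' _ _
  · intro s i t j
    simp [xop, dxop, pderiv_mulX, and_comm]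

theorem omegaEy_rel (a b c e : Fin n) :
    omegaEy p q n a b * omegaEy p q n c e - omegaEy p q n c e * omegaEy p q n a b =
      (if b = c then omegaEy p q n a e else 0) - (if a = e then omegaEy p q n c b else 0) := by
  refine oscillator (u := fun i s => yop p q n s i) (v := fun i s => dyop p q n s i)
    ((q : ℂ) / 2) ?_ ?_ ?_ _ (fun a b => rfl) a b c e
  · intro s i t j; exact mulX_comm _ _
  · intro s i t j; exact pderiv_comm' _ _
  · intro s i t j
    simp [yop, dyop, pderiv_mulX, and_comm]

theorem omegaEx_comm_omegaEy (a b c e : Fin n) :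
    Commute (omegaEx p q n a b) (omegaEy p q n c e) := by
  have h1 : ∀ s i t j, Commute (xop p q n s i) (yop p q n t j) := fun _ _ _ _ => mulX_comm _ _
  have h2 : ∀ s i t j, Commute (dxop p q n s i) (dyop p q n t j) :=
    fun _ _ _ _ => pderiv_comm' _ _
  have h3 : ∀ s i t j, Commute (dxop p q n s i) (yop p q n t j) := fun _ _ _ _ => by
    simp [Commute, SemiconjBy, dxop, yop, pderiv_mulX]
  have h4 : ∀ s i t j, Commute (xop p q n s i) (dyop p q n t j) := fun _ _ _ _ => by
    simp [Commute, SemiconjBy, dyop, xop, pderiv_mulX]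
  unfold omegaEx omegaEy
  refine Commute.add_left (Commute.add_right ?_ ?_) ?_
  · exact Commute.sum_left _ _ _ fun i _ => Commute.sum_right _ _ _ fun j _ =>
      ((h1 _ _ _ _).mul_left (h3 _ _ _ _)).mul_right ((h4 _ _ _ _).mul_left (h2 _ _ _ _))
  · split_ifs
    · exact (Commute.one_right _).smul_right _
    · exact Commute.zero_right _
  · by_cases h : a = b
    · rw [if_pos h]
      exact (Commute.one_left _).smul_left _
    · rw [if_neg h]
      exact Commute.zero_left _

/-- The Weil representation restricted to `𝔤`: `Z ↦ ∑ Z_{ab} ω(E_{ab})`. -/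
def omegaLieG : 𝔤 p q →ₗ⁅ℂ⁆ Module.End ℂ (Pol p q n) :=
  glLieHom (omegaUnit p q n) (omegaUnit_rel p q n)

/-- The Weil representation restricted to `𝔪`:
`(Z, W) ↦ ∑ Z_{st} ω(E^{(x)}_{st}) + ∑ W_{st} ω(E^{(y)}_{st})`. -/
def omegaLieM : 𝔪 n →ₗ⁅ℂ⁆ Module.End ℂ (Pol p q n) where
  toFun Z := glLieHom (omegaEx p q n) (omegaEx_rel p q n) Z.1 +
    glLieHom (omegaEy p q n) (omegaEy_rel p q n) Z.2
  map_add' Z W := by simp only [Prod.fst_add, Prod.snd_add, map_add]; abel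
  map_smul' r Z := by simp
  map_lie' := by
    intro Z W
    have hc : ∀ A B : Matrix (Fin n) (Fin n) ℂ,
        ⁅glLieHom (omegaEx p q n) (omegaEx_rel p q n) A,
          glLieHom (omegaEy p q n) (omegaEy_rel p q n) B⁆ = 0 := by
      intro A B
      rw [LieRing.of_associative_ring_bracket, sub_eq_zero]
      exact Commute.sum_left _ _ _ fun a _ => Commute.sum_left _ _ _ fun b _ =>
        Commute.sum_right _ _ _ fun c _ => Commute.sum_right _ _ _ fun e _ =>
          ((omegaEx_comm_omegaEy p q n a b c e).smul_left _).smul_right _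
    have hc' := hc W.1 Z.2
    rw [← lie_skew, neg_eq_zero] at hc'
    simp [hc, hc']

/-- The Weil representation `ω` on `U(𝔤)`. -/
def omegaG : Ug p q →ₐ[ℂ] Module.End ℂ (Pol p q n) :=
  UniversalEnvelopingAlgebra.lift ℂ (omegaLieG p q n)

/-- The Weil representation `ω` on `U(𝔪)`. -/
def omegaM : Um n →ₐ[ℂ] Module.End ℂ (Pol p q n) :=
  UniversalEnvelopingAlgebra.lift ℂ (omegaLieM p q n)

end operators

end CapelliC

end

noncomputable section

namespace CapelliC

/-! ### Column-determinants -/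

section colDet

variable {A : Type*} [Ring A]

/-! For the operator identity, both sides are written in normal order, with coordinates to the left
of derivatives. On the 𝔤 side, `G_{ij}` acts as multiplication by the polynomial `√-1 (ᵗx y)_{ij}`
and `F_{ji}` as the constant-coefficient operator with the same symbol (`crossMat`). Cauchy–Binet
then turns the image of `X_d` into `(-1)^d ∑ x_{SI} y_{SJ} ∂x_{TI} ∂y_{TJ}`, where `x_{SI}` and its
analogues denote minors and `S, T, I, J` run over `d`-subsets.

On the 𝔪 side the constants `p/2` and `q/2` of `ω` cancel those in the shifts, so each shifted minor
becomes a column-determinant of polarization operators with diagonal shifts `d - b`. The classical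
Capelli identity (`colDet_shiftedMat_polarOp_eq_sum_sub`) evaluates it as `∑_I x_{SI} ∂x_{TI}`. As
x-derivatives commute with multiplication by `y`, the two expressions agree
(`omegaG_pseudoSym_Xgen`). When `n < d` the sum over `S, T` is empty, so both sides vanish.

Invariance is proved in `U(𝔪)` itself. Shifted minors make sense for arbitrary index sequences and
are alternating in them: in the rows by reindexing permutations, in the columns because shifts
dropping by one per column compensate the commutators (`colDet_shiftedMat_comp_right`). Hence
`(d!)²` times the sum over subsets is the sum over all sequences. There `H` acts on the two families
of minors by mutually contragredient matrices built from tensor powers, so the contraction is fixed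
(`map_sum_colDet_mul_colDet`). -/

theorem colDet_eq_det {R : Type*} [CommRing R] {d : ℕ} (Z : Matrix (Fin d) (Fin d) R) :
    colDet Z = Z.det := by
  simp only [colDet, Matrix.det_apply, List.prod_ofFn, Units.smul_def]

theorem map_colDet {B F : Type*} [Ring B] [FunLike F A B] [RingHomClass F A B] (f : F) {d : ℕ}
    (Z : Matrix (Fin d) (Fin d) A) : f (colDet Z) = colDet (Z.map f) := by
  simp only [colDet, map_sum, map_zsmul, map_list_prod, List.map_ofFn, Matrix.map_apply]
  rfl

/-- The factors are ordered by columns, so a row permutation only reindexes the sum over `σ`; no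
commutativity is needed. The column analogue fails in general. -/
theorem colDet_permute_rows {d : ℕ} (τ : Equiv.Perm (Fin d)) (Z : Matrix (Fin d) (Fin d) A) :
    colDet (Z.submatrix τ id) = (Equiv.Perm.sign τ : ℤ) • colDet Z := by
  simp only [colDet, Finset.smul_sum, smul_smul]
  refine Fintype.sum_equiv (Equiv.mulLeft τ) _ _ fun σ => ?_
  have h : ((Equiv.Perm.sign τ : ℤ) * (Equiv.Perm.sign τ : ℤ)) = 1 := by
    rw [← Units.val_mul, Int.units_mul_self, Units.val_one]
  simp only [Equiv.coe_mulLeft, Equiv.Perm.sign_mul, Units.val_mul, ← mul_assoc, h, one_mul]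
  rfl

/-- Laplace expansion along the first column survives without commutativity because the entry of
that column is the leftmost factor of every product. -/
theorem colDet_succ {d : ℕ} (Z : Matrix (Fin (d + 1)) (Fin (d + 1)) A) :
    colDet Z = ∑ i : Fin (d + 1),
      ((-1) ^ (i : ℕ) : ℤ) • (Z i 0 * colDet (Z.submatrix i.succAbove Fin.succ)) := by
  rw [colDet, Finset.univ_perm_fin_succ, ← Finset.univ_product_univ]
  simp only [Finset.sum_map, Equiv.toEmbedding_apply, Finset.sum_product]
  refine Finset.sum_congr rfl fun i _ => ?_
  refine Fin.cases ?_ (fun i => ?_) i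
  · simp [colDet, List.ofFn_succ, Finset.mul_sum, Equiv.Perm.decomposeFin.symm_sign,
      -zsmul_eq_mul]
  -- Deleting row `i + 1` and swapping it with row `0` before deleting the top row leave the same
  -- rows, up to a cycle of sign `(-1)^i`. Against `(-1)^(i+1)` this leaves `-1`, the sign of the
  -- transposition in `decomposeFin`.
  · have h : (Z.submatrix i.succ.succAbove Fin.succ) =
        ((Z.submatrix (Equiv.swap 0 i.succ) id).submatrix Fin.succ Fin.succ).submatrix
          i.cycleRange.symm id := by
      ext a b
      simp [← Fin.succAbove_cycleRange]
    rw [h, colDet_permute_rows, Equiv.Perm.sign_symm, Fin.sign_cycleRange, mul_smul_comm,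
      smul_smul]
    have h1 : ((-1 : ℤ) ^ (i.succ : ℕ) * (((-1 : ℤˣ) ^ (i : ℕ) : ℤˣ) : ℤ)) = -1 := by
      push_cast
      rw [← pow_add, Fin.val_succ, show (i : ℕ) + 1 + i = 2 * i + 1 by ring, pow_succ, pow_mul]
      simp
    rw [h1, colDet, Finset.mul_sum, Finset.smul_sum]
    refine Finset.sum_congr rfl fun σ _ => ?_
    rw [Equiv.Perm.decomposeFin.symm_sign, if_neg (Fin.succ_ne_zero i)]
    simp [List.ofFn_succ, -zsmul_eq_mul]

end colDet

/-! ### Sums over index functions and over subsets -/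

theorem Sub.el_injective {k d : ℕ} (I : Sub k d) : Function.Injective I.el :=
  (I.1.orderEmbOfFin I.2).injective

theorem Sub.range_el {k d : ℕ} (I : Sub k d) : Set.range I.el = I.1 :=
  Finset.range_orderEmbOfFin I.1 I.2

/-- A sum over index functions whose terms vanish at non-injective functions. -/
theorem sum_fun_eq_sum_sub {k d : ℕ} {M : Type*} [AddCommMonoid M] (F : (Fin d → Fin k) → M)
    (hF : ∀ i, ¬ Function.Injective i → F i = 0) :
    ∑ i, F i = ∑ I : Sub k d, ∑ σ : Equiv.Perm (Fin d), F (I.el ∘ σ) := by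
  rw [← Fintype.sum_prod_type' (f := fun (I : Sub k d) (σ : Equiv.Perm (Fin d)) => F (I.el ∘ σ))]
  symm
  refine Finset.sum_of_injOn (fun x => x.1.el ∘ x.2) ?_ ?_ ?_ ?_
  · rintro ⟨I, σ⟩ - ⟨J, τ⟩ - h
    have h' : I.el ∘ σ = J.el ∘ τ := h
    have hIJ : I = J := by
      apply Subtype.ext
      apply Finset.coe_injective
      rw [← I.range_el, ← J.range_el, ← σ.surjective.range_comp, h', τ.surjective.range_comp]
    subst hIJ
    have : σ = τ := Equiv.ext fun b => I.el_injective (congrFun h' b)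
    rw [this]
  · intro _ _; simp
  · intro i _ hi
    apply hF
    intro hinj
    apply hi
    -- An injective index function factors uniquely as the increasing enumeration of its image after
    -- a permutation.
    let I : Sub k d := ⟨Finset.univ.map ⟨i, hinj⟩, by simp⟩
    have hex : ∀ b, ∃ c, I.el c = i b := by
      intro b
      have : i b ∈ Set.range I.el := by rw [I.range_el]; simp [I]
      exact this
    choose c hc using hex
    have hcinj : Function.Injective c := fun a b hab => hinj (by rw [← hc, ← hc, hab])
    refine ⟨(I, Equiv.ofBijective c (Finite.injective_iff_bijective.1 hcinj)), by simp, ?_⟩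
    funext b
    exact hc b
  · intro _ _; rfl

/-- A sum over index functions of a symmetric expression. -/
theorem sum_fun_eq_factorial_smul {k d : ℕ} {M : Type*} [AddCommMonoid M]
    (F : (Fin d → Fin k) → M) (hF : ∀ i, ¬ Function.Injective i → F i = 0)
    (hs : ∀ i (σ : Equiv.Perm (Fin d)), F (i ∘ σ) = F i) :
    ∑ i, F i = d.factorial • ∑ I : Sub k d, F I.el := by
  rw [sum_fun_eq_sum_sub F hF, Finset.smul_sum]
  refine Finset.sum_congr rfl fun I _ => ?_
  simp [hs, Fintype.card_perm]

theorem det_submatrix_comp_eq_zero {R : Type*} [CommRing R] {m d k : ℕ}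
    (X : Matrix (Fin m) (Fin k) R) (s : Fin d → Fin m) (i : Fin d → Fin k)
    (hi : ¬ Function.Injective i) : (X.submatrix s i).det = 0 := by
  simp only [Function.Injective, not_forall] at hi
  obtain ⟨a, b, hab, hne⟩ := hi
  exact Matrix.det_zero_of_column_eq hne fun c => by simp [hab]

/-- Minors along index functions, summed against products of entries, regroup into minors. -/
theorem sum_det_prod_eq_sum_det_det {R M : Type*} [CommRing R] [AddCommGroup M] {m m' d k : ℕ}
    (X : Matrix (Fin m) (Fin k) R) (Y : Matrix (Fin m') (Fin k) R)
    (s : Fin d → Fin m) (t : Fin d → Fin m') (β : R →+ R →+ M) :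
    (∑ i : Fin d → Fin k, β (X.submatrix s i).det (∏ b, Y (t b) (i b)) : M) =
      ∑ I : Sub k d, β (X.submatrix s I.el).det (Y.submatrix t I.el).det := by
  rw [sum_fun_eq_sum_sub]
  · refine Finset.sum_congr rfl fun I _ => ?_
    -- The minor of `X` picks up `sgn σ` when its columns are permuted; this sign antisymmetrises
    -- the product of entries of `Y` into a determinant.
    rw [← Matrix.det_transpose (Y.submatrix t I.el),
      Matrix.det_apply (Y.submatrix t I.el).transpose, map_sum]
    refine Finset.sum_congr rfl fun σ _ => ?_
    have h : (X.submatrix s (I.el ∘ σ)).det =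
        (Equiv.Perm.sign σ : ℤ) • (X.submatrix s I.el).det := by
      rw [zsmul_eq_mul, ← Matrix.det_permute']
      rfl
    rw [h, map_zsmul, AddMonoidHom.smul_apply, Units.smul_def, map_zsmul]
    rfl
  · intro i hi
    rw [det_submatrix_comp_eq_zero X s i hi, map_zero, AddMonoidHom.zero_apply]

/-- The Cauchy–Binet formula. -/
theorem det_mul_eq_sum_det_det {R : Type*} [CommRing R] {k d : ℕ}
    (X : Matrix (Fin d) (Fin k) R) (Y : Matrix (Fin k) (Fin d) R) :
    (X * Y).det = ∑ I : Sub k d, (X.submatrix id I.el).det * (Y.submatrix I.el id).det := by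
  -- Here the biadditive pairing is multiplication in `R`; the Capelli identity reuses the lemma
  -- with `f, g ↦ mulOp f * diffOp g`.
  have h := sum_det_prod_eq_sum_det_det X Y.transpose id id (AddMonoidHom.mul (R := R))
  simp only [AddMonoidHom.mul_apply] at h
  have h2 : ∀ I : Sub k d, (Y.transpose.submatrix id I.el).det = (Y.submatrix I.el id).det :=
    fun I => by rw [← Matrix.det_transpose]; rfl
  simp only [h2] at h
  rw [← h]
  simp only [Matrix.det_apply, Finset.sum_mul, Matrix.mul_apply, Finset.prod_univ_sum,
    Fintype.piFinset_univ, Finset.smul_sum]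
  rw [Finset.sum_comm]
  refine Finset.sum_congr rfl fun i _ => Finset.sum_congr rfl fun σ _ => ?_
  simp [Finset.prod_mul_distrib, smul_mul_assoc]

/-! ### Derivations and determinants -/

theorem derivation_prod {R B ι : Type*} [CommRing R] [CommRing B] [Algebra R B] [DecidableEq ι]
    (D : Derivation R B B) (s : Finset ι) (f : ι → B) :
    D (∏ i ∈ s, f i) = ∑ c ∈ s, ∏ i ∈ s, if i = c then D (f i) else f i := by
  induction s using Finset.induction_on with
  | empty => simp
  | insert a s ha ih =>
    rw [Finset.prod_insert ha, Derivation.leibniz, ih, Finset.sum_insert ha, Finset.prod_insert ha,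
      if_pos rfl, smul_eq_mul, smul_eq_mul, add_comm, mul_comm, Finset.mul_sum]
    congr 1
    · congr 1
      exact Finset.prod_congr rfl fun i hi => by rw [if_neg (by rintro rfl; exact ha hi)]
    · refine Finset.sum_congr rfl fun c hc => ?_
      rw [Finset.prod_insert ha, if_neg (by rintro rfl; exact ha hc)]

theorem derivation_det {R B : Type*} [CommRing R] [CommRing B] [Algebra R B] {d : ℕ}
    (D : Derivation R B B) (N : Matrix (Fin d) (Fin d) B) :
    D N.det = ∑ c, (N.updateCol c fun a => D (N a c)).det := by
  simp only [Matrix.det_apply, map_sum, Units.smul_def, map_zsmul, derivation_prod,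
    Finset.smul_sum]
  rw [Finset.sum_comm]
  refine Finset.sum_congr rfl fun c _ => Finset.sum_congr rfl fun σ _ => ?_
  congr 1
  refine Finset.prod_congr rfl fun b _ => ?_
  by_cases h : b = c
  · subst h; simp
  · simp [h]

/-! ### Shifted minors -/

section shiftedMat

variable {A ι : Type*} [Ring A] [DecidableEq ι]

/-- The matrix `(E_{s_a t_b} + (d - b) δ_{s_a t_b})`, with columns numbered from `1` to `d`. -/
def shiftedMat {d : ℕ} (E : ι → ι → A) (s t : Fin d → ι) : Matrix (Fin d) (Fin d) A :=
  Matrix.of fun a b => E (s a) (t b) +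
    if s a = t b then (((d : ℤ) - ((b : ℕ) + 1) : ℤ) : A) else 0

/-- The shifts are integers, hence preserved by every ring homomorphism. -/
theorem map_colDet_shiftedMat {B F : Type*} [Ring B] [FunLike F A B] [RingHomClass F A B] (f : F)
    {d : ℕ} (E : ι → ι → A) (s t : Fin d → ι) :
    f (colDet (shiftedMat E s t)) = colDet (shiftedMat (fun a b => f (E a b)) s t) := by
  rw [map_colDet]
  congr 1
  ext a b
  simp only [shiftedMat, Matrix.map_apply, Matrix.of_apply, map_add, apply_ite f, map_intCast,
    map_zero]

/-- The shift `d - b` counts columns from the right end, so deleting the first column leaves a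
matrix of the same shape; this makes induction on `d` possible. -/
theorem colDet_shiftedMat_succ {d : ℕ} (E : ι → ι → A) (s t : Fin (d + 1) → ι) :
    colDet (shiftedMat E s t) = ∑ a : Fin (d + 1), ((-1) ^ (a : ℕ) : ℤ) •
      ((E (s a) (t 0) + if s a = t 0 then (d : A) else 0) *
        colDet (shiftedMat E (s ∘ a.succAbove) (t ∘ Fin.succ))) := by
  rw [colDet_succ]
  refine Finset.sum_congr rfl fun a _ => ?_
  congr 2
  · simp [shiftedMat]
  · congr 1
    ext i j
    simp [shiftedMat]

theorem colDet_shiftedMat_comp_left {d : ℕ} (E : ι → ι → A) (s t : Fin d → ι)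
    (τ : Equiv.Perm (Fin d)) :
    colDet (shiftedMat E (s ∘ τ) t) = (Equiv.Perm.sign τ : ℤ) • colDet (shiftedMat E s t) := by
  rw [← colDet_permute_rows]
  rfl

end shiftedMat

/-! ### Differential operators with constant coefficients -/

section diffOp

variable {σ : Type*}

/-- Multiplication operators on polynomials. -/
def mulOp : MvPolynomial σ ℂ →ₐ[ℂ] Module.End ℂ (MvPolynomial σ ℂ) :=
  Algebra.lmul ℂ (MvPolynomial σ ℂ)

theorem mulOp_apply (f g : MvPolynomial σ ℂ) : mulOp f g = f * g := rfl

open scoped IsMulCommutative in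
/-- The differential operator with constant coefficients attached to a polynomial. -/
def diffOp : MvPolynomial σ ℂ →ₐ[ℂ] Module.End ℂ (MvPolynomial σ ℂ) :=
  -- Evaluation of polynomials needs a commutative target, so it is made in the subalgebra generated
  -- by the partial derivatives.
  let S : Set (Module.End ℂ (MvPolynomial σ ℂ)) :=
    Set.range fun v => (MvPolynomial.pderiv v).toLinearMap
  have : IsMulCommutative (Algebra.adjoin ℂ S) := Algebra.isMulCommutative_adjoin ℂ <| by
    rintro _ ⟨v, rfl⟩ _ ⟨w, rfl⟩
    exact pderiv_comm' v w
  (Algebra.adjoin ℂ S).val.comp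
    (MvPolynomial.aeval fun v => ⟨(MvPolynomial.pderiv v).toLinearMap,
      Algebra.subset_adjoin ⟨v, rfl⟩⟩)

theorem diffOp_X (v : σ) : diffOp (MvPolynomial.X v) =
    ((MvPolynomial.pderiv v).toLinearMap : Module.End ℂ (MvPolynomial σ ℂ)) := by
  simp [diffOp]

theorem diffOp_X_mul_mulOp (v : σ) (f : MvPolynomial σ ℂ) :
    diffOp (MvPolynomial.X v) * mulOp f =
      mulOp f * diffOp (MvPolynomial.X v) + mulOp (MvPolynomial.pderiv v f) := by
  rw [diffOp_X]
  refine LinearMap.ext fun g => ?_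
  simp [mulOp_apply, Derivation.leibniz, mul_comm]

end diffOp

/-! ### The Capelli identity -/

section capelli

variable {σ : Type*} {n p : ℕ} (x : Fin n → Fin p → σ)

/-- A matrix of distinct variables. -/
def varMat : Matrix (Fin n) (Fin p) (MvPolynomial σ ℂ) := Matrix.of fun s i => MvPolynomial.X (x s i)

variable (hx : ∀ s i t j, x s i = x t j → s = t ∧ i = j)

include hx in
-- This is the cancellation that forces the shift. Border the minors by a first column `δ_{s_a,t}`
-- to get `M`. Differentiating column `c` of a minor replaces it by that `δ`-column, while the
-- factor `x_{s_a,i_c}` takes the first place: the expansion of `M` with two columns swapped. The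
-- `d` columns give `-d · det M`, and the diagonal term gives `+d · det M`.
theorem polarization_det {d : ℕ} (s : Fin (d + 1) → Fin n) (t : Fin n) (i : Fin d → Fin p) :
    ∑ a : Fin (d + 1), (-1) ^ (a : ℕ) *
      (∑ j, varMat x (s a) j * MvPolynomial.pderiv (x t j)
          ((varMat x).submatrix (s ∘ a.succAbove) i).det +
        (if s a = t then (d : MvPolynomial σ ℂ) else 0) *
          ((varMat x).submatrix (s ∘ a.succAbove) i).det) = 0 := by
  classical
  let M : Matrix (Fin (d + 1)) (Fin (d + 1)) (MvPolynomial σ ℂ) :=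
    Matrix.of fun a => Fin.cons (if s a = t then 1 else 0) fun b => varMat x (s a) (i b)
  have hpd : ∀ a j c, MvPolynomial.pderiv (x t j) (varMat x a c) =
      if a = t ∧ c = j then 1 else 0 := by
    intro a j c
    simp only [varMat, Matrix.of_apply, MvPolynomial.pderiv_X, Pi.single_apply]
    refine if_congr ⟨fun h => hx _ _ _ _ h, ?_⟩ rfl rfl
    rintro ⟨rfl, rfl⟩; rfl
  have hsub : ∀ (a : Fin (d + 1)) (c : Fin d),
      ((varMat x).submatrix (s ∘ a.succAbove) i).updateCol c
          (fun e => if s (a.succAbove e) = t then 1 else 0) =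
        (M.submatrix id (Equiv.swap 0 c.succ)).submatrix a.succAbove Fin.succ := by
    intro a c
    ext1 e b
    by_cases h : b = c
    · subst h; simp [M]
    · simp [M, h, Equiv.swap_apply_of_ne_of_ne (Fin.succ_ne_zero b)
        (fun h' => h (Fin.succ_injective _ h'))]
  have h1 : ∀ a : Fin (d + 1), ∑ j, varMat x (s a) j * MvPolynomial.pderiv (x t j)
        ((varMat x).submatrix (s ∘ a.succAbove) i).det =
      ∑ c : Fin d, (M.submatrix id (Equiv.swap 0 c.succ)) a 0 *
        ((M.submatrix id (Equiv.swap 0 c.succ)).submatrix a.succAbove Fin.succ).det := by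
    intro a
    simp only [derivation_det, Finset.mul_sum]
    rw [Finset.sum_comm]
    refine Finset.sum_congr rfl fun c _ => ?_
    -- Only the variable `x_{t,i_c}` occurs in column `c` among the `x_{t,j}`, unless `j = i_c` the
    -- derived column is zero.
    rw [Finset.sum_eq_single (i c)]
    · rw [← hsub]
      simp [M, hpd]
    · intro j _ hj
      rw [Matrix.det_eq_zero_of_column_eq_zero c, mul_zero]
      intro e
      simp [hpd, hj.symm]
    · simp
  have h2 : ∀ c : Fin d, (M.submatrix id (Equiv.swap 0 c.succ)).det = -M.det := by
    intro c
    rw [Matrix.det_permute', Equiv.Perm.sign_swap (Fin.succ_ne_zero c).symm]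
    simp
  have h3 : M.det = ∑ a : Fin (d + 1), (-1) ^ (a : ℕ) *
      ((if s a = t then 1 else 0) * ((varMat x).submatrix (s ∘ a.succAbove) i).det) := by
    rw [Matrix.det_succ_column_zero]
    refine Finset.sum_congr rfl fun a _ => ?_
    rw [mul_assoc]
    rfl
  simp only [mul_add, Finset.sum_add_distrib, h1]
  have h4 : ∑ a : Fin (d + 1), (-1) ^ (a : ℕ) *
      ∑ c : Fin d, (M.submatrix id (Equiv.swap 0 c.succ)) a 0 *
        ((M.submatrix id (Equiv.swap 0 c.succ)).submatrix a.succAbove Fin.succ).det =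
      -((d : MvPolynomial σ ℂ) * M.det) := by
    simp only [Finset.mul_sum, ← mul_assoc]
    rw [Finset.sum_comm]
    simp only [← Matrix.det_succ_column_zero, h2]
    simp
  rw [h4, h3, Finset.mul_sum, neg_add_eq_zero]
  refine Finset.sum_congr rfl fun a _ => ?_
  split_ifs <;> ring

/-- The polarization operators `∑ᵢ x_{si} ∂/∂x_{ti}`. -/
def polarOp (s t : Fin n) : Module.End ℂ (MvPolynomial σ ℂ) :=
  ∑ i, mulOp (varMat x s i) * diffOp (varMat x t i)

include hx in
/-- The Capelli identity in normally ordered form, for arbitrary row and column indices. -/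
theorem colDet_shiftedMat_polarOp {d : ℕ} (s t : Fin d → Fin n) :
    colDet (shiftedMat (polarOp x) s t) = ∑ i : Fin d → Fin p,
      mulOp ((varMat x).submatrix s i).det * diffOp (∏ b, varMat x (t b) (i b)) := by
  induction d with
  | zero => simp [colDet]
  | succ d ih =>
    rw [colDet_shiftedMat_succ]
    simp only [ih, Finset.mul_sum, Finset.smul_sum]
    -- The index function of length `d + 1` is split into its head `j`, the summation index of the
    -- polarization operator, and its tail `i`, from the induction hypothesis.
    rw [Finset.sum_comm, ← (Fin.consEquiv fun _ => Fin p).sum_comp, Fintype.sum_prod_type_right]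
    refine Finset.sum_congr rfl fun i _ => ?_
    -- Moving `∂/∂x_{t_0 j}` to the right past `f` gives a normally ordered term plus a term in the
    -- derivative of `f`, which is collected with the shift.
    have h1 : ∀ (a : Fin (d + 1)) (f : MvPolynomial σ ℂ) (Q : Module.End ℂ (MvPolynomial σ ℂ)),
        (polarOp x (s a) (t 0) + if s a = t 0 then (d : Module.End ℂ (MvPolynomial σ ℂ)) else 0) *
          (mulOp f * Q) =
        ∑ j, mulOp (varMat x (s a) j * f) * (diffOp (varMat x (t 0) j) * Q) +
          mulOp (∑ j, varMat x (s a) j * MvPolynomial.pderiv (x (t 0) j) f +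
            (if s a = t 0 then (d : MvPolynomial σ ℂ) else 0) * f) * Q := by
      intro a f Q
      have h2 : (if s a = t 0 then (d : Module.End ℂ (MvPolynomial σ ℂ)) else 0) =
          mulOp (if s a = t 0 then (d : MvPolynomial σ ℂ) else 0) := by
        split_ifs <;> simp
      rw [h2, polarOp, add_mul, Finset.sum_mul, map_add, map_sum, add_mul, ← add_assoc,
        Finset.sum_mul, ← Finset.sum_add_distrib, map_mul, mul_assoc (mulOp _) (mulOp f) Q]
      congr 1
      refine Finset.sum_congr rfl fun j _ => ?_
      have h3 : diffOp (varMat x (t 0) j) * mulOp f = mulOp f * diffOp (varMat x (t 0) j) +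
          mulOp (MvPolynomial.pderiv (x (t 0) j) f) := diffOp_X_mul_mulOp _ f
      rw [mul_assoc, ← mul_assoc (diffOp _), h3, map_mul, map_mul]
      noncomm_ring
    simp only [h1, smul_add, Finset.sum_add_distrib]
    have hz : ∀ (a : ℕ) (f : MvPolynomial σ ℂ), (((-1) ^ a : ℤ) • mulOp f) =
        mulOp ((-1) ^ a * f) := by
      intro a f
      rw [← map_zsmul, zsmul_eq_mul]
      simp
    -- The collected correction terms vanish after the alternating sum over `a`.
    have h5 : ∑ a : Fin (d + 1), ((-1) ^ (a : ℕ) : ℤ) •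
        (mulOp (∑ j, varMat x (s a) j * MvPolynomial.pderiv (x (t 0) j)
            ((varMat x).submatrix (s ∘ a.succAbove) i).det +
          (if s a = t 0 then (d : MvPolynomial σ ℂ) else 0) *
            ((varMat x).submatrix (s ∘ a.succAbove) i).det) *
          diffOp (∏ b, varMat x ((t ∘ Fin.succ) b) (i b))) = 0 := by
      simp only [← smul_mul_assoc, hz, ← Finset.sum_mul, ← map_sum]
      rw [polarization_det x hx, map_zero, zero_mul]
    rw [h5, add_zero]
    simp only [Finset.smul_sum]
    rw [Finset.sum_comm]
    refine Finset.sum_congr rfl fun j _ => ?_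
    simp only [← smul_mul_assoc, hz, ← Finset.sum_mul, ← map_sum]
    -- The surviving terms are the Laplace expansion of the larger minor along its new first column.
    have h6 : ((varMat x).submatrix s (Fin.consEquiv (fun _ => Fin p) (j, i))).det =
        ∑ a : Fin (d + 1), (-1) ^ (a : ℕ) *
          (varMat x (s a) j * ((varMat x).submatrix (s ∘ a.succAbove) i).det) := by
      rw [Matrix.det_succ_column_zero]
      refine Finset.sum_congr rfl fun a _ => ?_
      rw [mul_assoc]
      rfl
    have h7 : ∏ b, varMat x (t b) (Fin.consEquiv (fun _ => Fin p) (j, i) b) =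
        varMat x (t 0) j * ∏ b, varMat x ((t ∘ Fin.succ) b) (i b) :=
      Fin.prod_univ_succ _
    rw [h6, h7, map_mul]

include hx in
/-- The Capelli identity for a minor of the matrix of polarization operators. -/
theorem colDet_shiftedMat_polarOp_eq_sum_sub {d : ℕ} (s t : Fin d → Fin n) :
    colDet (shiftedMat (polarOp x) s t) = ∑ I : Sub p d,
      mulOp ((varMat x).submatrix s I.el).det * diffOp ((varMat x).submatrix t I.el).det := by
  rw [colDet_shiftedMat_polarOp x hx]
  exact sum_det_prod_eq_sum_det_det (varMat x) (varMat x) s t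
    (((AddMonoidHom.mul (R := Module.End ℂ (MvPolynomial σ ℂ))).compr₂ (AddMonoidHom.id _)).compl₂
      (diffOp : MvPolynomial σ ℂ →ₐ[ℂ] _).toRingHom.toAddMonoidHom |>.comp
      (mulOp : MvPolynomial σ ℂ →ₐ[ℂ] _).toRingHom.toAddMonoidHom)

end capelli

/-! ### The Weil representation on both sides -/

/-- A derivative in one set of variables kills polynomials in the other, so the commutator vanishes
on generators and hence for all symbols `f`. -/
theorem diffOp_rename_mul_mulOp_rename {σ τ : Type*} (f : MvPolynomial σ ℂ)
    (g : MvPolynomial τ ℂ) :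
    diffOp (MvPolynomial.rename (Sum.inl : σ → σ ⊕ τ) f) *
        mulOp (MvPolynomial.rename Sum.inr g) =
      mulOp (MvPolynomial.rename Sum.inr g) * diffOp (MvPolynomial.rename Sum.inl f) := by
  have hd : ∀ v : σ, MvPolynomial.pderiv (Sum.inl v : σ ⊕ τ) (MvPolynomial.rename Sum.inr g) = 0 := by
    intro v
    induction g using MvPolynomial.induction_on with
    | C a => simp
    | add f g hf hg => simp [hf, hg]
    | mul_X f w hf => simp [hf, Derivation.leibniz]
  change Commute _ _
  induction f using MvPolynomial.induction_on with
  | C a =>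
    rw [MvPolynomial.rename_C, ← MvPolynomial.algebraMap_eq, AlgHom.commutes]
    exact Algebra.commutes a _
  | add f g hf hg =>
    rw [map_add, map_add]
    exact hf.add_left hg
  | mul_X f v hf =>
    rw [map_mul, map_mul, MvPolynomial.rename_X]
    refine hf.mul_left ?_
    rw [Commute, SemiconjBy, diffOp_X_mul_mulOp, hd, map_zero, add_zero]

variable (p q n : ℕ)

/-- The variables `x_{si}`. -/
abbrev xvar (s : Fin n) (i : Fin p) : (Fin n × Fin p) ⊕ (Fin n × Fin q) := Sum.inl (s, i)

/-- The variables `y_{sj}`. -/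
abbrev yvar (s : Fin n) (j : Fin q) : (Fin n × Fin p) ⊕ (Fin n × Fin q) := Sum.inr (s, j)

theorem diffOp_xdet_mul_mulOp_ydet {d : ℕ} (s s' : Fin d → Fin n) (i : Fin d → Fin p)
    (j : Fin d → Fin q) :
    diffOp ((varMat (xvar p q n)).submatrix s i).det *
        mulOp ((varMat (yvar p q n)).submatrix s' j).det =
      mulOp ((varMat (yvar p q n)).submatrix s' j).det *
        diffOp ((varMat (xvar p q n)).submatrix s i).det := by
  have h1 : (varMat (xvar p q n)).submatrix s i =
      (MvPolynomial.rename Sum.inl).mapMatrix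
        ((varMat (Prod.mk : Fin n → Fin p → _)).submatrix s i) := by
    ext1 a b; simp [varMat]
  have h2 : (varMat (yvar p q n)).submatrix s' j =
      (MvPolynomial.rename Sum.inr).mapMatrix
        ((varMat (Prod.mk : Fin n → Fin q → _)).submatrix s' j) := by
    ext1 a b; simp [varMat]
  rw [h1, h2, ← AlgHom.map_det, ← AlgHom.map_det]
  exact diffOp_rename_mul_mulOp_rename _ _

/-- The complex constant is absorbed into the generators, leaving integer shifts only. For `c = p/2`
or `q/2` the modified generators act as pure polarization operators. -/
theorem shiftedMinor_eq {d : ℕ} (E : Fin n → Fin n → Um n) (c : ℂ) (S T : Sub n d) :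
    shiftedMinor E c S T = colDet (shiftedMat
      (fun s t => E s t - if s = t then algebraMap ℂ (Um n) c else 0) S.el T.el) := by
  unfold shiftedMinor shiftedMat
  congr 2
  funext a b
  by_cases h : S.el a = T.el b
  · simp only [h, if_true, map_sub, map_add, map_natCast, map_one]
    push_cast
    abel
  · simp [h]

theorem omegaM_Ex (s t : Fin n) : omegaM p q n (Ex n s t) = omegaEx p q n s t := by
  rw [omegaM, Ex, UniversalEnvelopingAlgebra.lift_ι_apply]
  change glLieHom (omegaEx p q n) (omegaEx_rel p q n) _ +
    glLieHom (omegaEy p q n) (omegaEy_rel p q n) _ = _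
  rw [glLieHom_single, map_zero, add_zero]

theorem omegaM_Ey (s t : Fin n) : omegaM p q n (Ey n s t) = omegaEy p q n s t := by
  rw [omegaM, Ey, UniversalEnvelopingAlgebra.lift_ι_apply]
  change glLieHom (omegaEx p q n) (omegaEx_rel p q n) _ +
    glLieHom (omegaEy p q n) (omegaEy_rel p q n) _ = _
  rw [glLieHom_single, map_zero, zero_add]

theorem omegaM_shiftedMinor_Ex {d : ℕ} (S T : Sub n d) :
    omegaM p q n (shiftedMinor (Ex n) ((p : ℂ) / 2) S T) = ∑ I : Sub p d,
      mulOp ((varMat (xvar p q n)).submatrix S.el I.el).det *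
        diffOp ((varMat (xvar p q n)).submatrix T.el I.el).det := by
  rw [shiftedMinor_eq, map_colDet_shiftedMat, ← colDet_shiftedMat_polarOp_eq_sum_sub]
  · congr 2
    funext s t
    rw [map_sub, omegaM_Ex, apply_ite (omegaM p q n), AlgHom.commutes, map_zero, omegaEx, polarOp,
      Algebra.algebraMap_eq_smul_one, add_sub_cancel_right]
    refine Finset.sum_congr rfl fun i _ => ?_
    rw [varMat, Matrix.of_apply, Matrix.of_apply, diffOp_X]
    rfl
  · intro s i t j h
    simpa using h

theorem omegaM_shiftedMinor_Ey {d : ℕ} (S T : Sub n d) :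
    omegaM p q n (shiftedMinor (Ey n) ((q : ℂ) / 2) S T) = ∑ J : Sub q d,
      mulOp ((varMat (yvar p q n)).submatrix S.el J.el).det *
        diffOp ((varMat (yvar p q n)).submatrix T.el J.el).det := by
  rw [shiftedMinor_eq, map_colDet_shiftedMat, ← colDet_shiftedMat_polarOp_eq_sum_sub]
  · congr 2
    funext s t
    rw [map_sub, omegaM_Ey, apply_ite (omegaM p q n), AlgHom.commutes, map_zero, omegaEy, polarOp,
      Algebra.algebraMap_eq_smul_one, add_sub_cancel_right]
    refine Finset.sum_congr rfl fun i _ => ?_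
    rw [varMat, Matrix.of_apply, Matrix.of_apply, diffOp_X]
    rfl
  · intro s i t j h
    simpa using h

/-- The matrix `√-1 ᵗx y` of polynomials. -/
def crossMat : Matrix (Fin p) (Fin q) (Pol p q n) :=
  Complex.I • ((varMat (xvar p q n)).transpose * varMat (yvar p q n))

theorem det_crossMat_submatrix {d : ℕ} (i : Fin d → Fin p) (j : Fin d → Fin q) :
    ((crossMat p q n).submatrix i j).det = Complex.I ^ d • ∑ S : Sub n d,
      ((varMat (xvar p q n)).submatrix S.el i).det *
        ((varMat (yvar p q n)).submatrix S.el j).det := by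
  have h : (crossMat p q n).submatrix i j = Complex.I •
      (((varMat (xvar p q n)).submatrix id i).transpose * (varMat (yvar p q n)).submatrix id j) :=
    rfl
  have hS : ∀ S : Sub n d,
      (((varMat (xvar p q n)).submatrix id i).transpose.submatrix id S.el).det =
        ((varMat (xvar p q n)).submatrix S.el i).det := fun S =>
    Matrix.det_transpose ((varMat (xvar p q n)).submatrix S.el i)
  rw [h, Matrix.det_smul_of_tower, Fintype.card_fin, det_mul_eq_sum_det_det]
  simp only [hS, Matrix.submatrix_submatrix, Function.comp_id, Function.id_comp]

/-- The first determinant lies in the image of `S(𝔭⁺)` and the second in that of `S(𝔭⁻)`, where the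
pseudo-symmetrization is given by algebra homomorphisms; their product is already in the required
order. -/
theorem pseudoSym_det_mul_det {d : ℕ} (i : Fin d → Fin p) (j : Fin d → Fin q) :
    pseudoSym p q (((Gmat p q).submatrix i j).det * ((Fmat p q).submatrix j i).det) =
      colDet (Matrix.of fun a b => UniversalEnvelopingAlgebra.ι ℂ
          (Matrix.single (Sum.inl (i a)) (Sum.inr (j b)) 1 : 𝔤 p q)) *
        colDet (Matrix.of fun a b => UniversalEnvelopingAlgebra.ι ℂ
          (Matrix.single (Sum.inr (j a)) (Sum.inl (i b)) 1 : 𝔤 p q)) := by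
  have hG : ∀ a b, splitS p q (SymmetricAlgebra.ι ℂ _ (Gel p q a b)) =
      Algebra.TensorProduct.includeLeft (R := ℂ) (S := ℂ) (B := SymmetricAlgebra ℂ (𝔭minus p q))
        (SymmetricAlgebra.ι ℂ _ (projPlus p q (Gel p q a b))) := by
    intro a b
    have h0 : projMinus p q (Gel p q a b) = 0 := by
      apply Subtype.ext
      ext (i | i) (j | j) <;> simp [projMinus, Gel, Matrix.toBlocks₂₁]
    simp [splitS, h0]
  have hF : ∀ a b, splitS p q (SymmetricAlgebra.ι ℂ _ (Fel p q a b)) =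
      Algebra.TensorProduct.includeRight (R := ℂ) (A := SymmetricAlgebra ℂ (𝔭plus p q))
        (SymmetricAlgebra.ι ℂ _ (projMinus p q (Fel p q a b))) := by
    intro a b
    have h0 : projPlus p q (Fel p q a b) = 0 := by
      apply Subtype.ext
      ext (i | i) (j | j) <;> simp [projPlus, Fel, Matrix.toBlocks₁₂]
    simp [splitS, h0]
  have hG' : splitS p q ((Gmat p q).submatrix i j).det =
      Algebra.TensorProduct.includeLeft (R := ℂ) (S := ℂ) (B := SymmetricAlgebra ℂ (𝔭minus p q))
      (Matrix.of fun a b => SymmetricAlgebra.ι ℂ _ (projPlus p q (Gel p q (i a) (j b)))).det := by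
    rw [AlgHom.map_det, AlgHom.map_det]
    congr 1
    ext1 a b
    exact hG _ _
  have hF' : splitS p q ((Fmat p q).submatrix j i).det =
      Algebra.TensorProduct.includeRight (R := ℂ) (A := SymmetricAlgebra ℂ (𝔭plus p q))
      (Matrix.of fun a b => SymmetricAlgebra.ι ℂ _ (projMinus p q (Fel p q (j a) (i b)))).det := by
    rw [AlgHom.map_det, AlgHom.map_det]
    congr 1
    ext1 a b
    exact hF _ _
  have h : pseudoSym p q (((Gmat p q).submatrix i j).det * ((Fmat p q).submatrix j i).det) =
      symPlus p q
        (Matrix.of fun a b => SymmetricAlgebra.ι ℂ _ (projPlus p q (Gel p q (i a) (j b)))).det *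
      symMinus p q
        (Matrix.of fun a b => SymmetricAlgebra.ι ℂ _ (projMinus p q (Fel p q (j a) (i b)))).det := by
    simp only [pseudoSym, LinearMap.comp_apply, AlgHom.toLinearMap_apply, map_mul, hG', hF']
    simp
  rw [h, ← colDet_eq_det, ← colDet_eq_det, map_colDet, map_colDet]
  congr 2
  · ext1 a b
    simp only [Matrix.map_apply, Matrix.of_apply, symPlus, symLift_ι]
    change UniversalEnvelopingAlgebra.ι ℂ (projPlus p q (Gel p q (i a) (j b))).1 = _
    congr 1
    ext (k | k) (l | l) <;> simp [projPlus, Gel, Matrix.toBlocks₁₂, Matrix.single_apply]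
  · ext1 a b
    simp only [Matrix.map_apply, Matrix.of_apply, symMinus, symLift_ι]
    change UniversalEnvelopingAlgebra.ι ℂ (projMinus p q (Fel p q (j a) (i b))).1 = _
    congr 1
    ext (k | k) (l | l) <;> simp [projMinus, Fel, Matrix.toBlocks₂₁, Matrix.single_apply]

theorem omegaG_single (a b : Fin p ⊕ Fin q) :
    omegaG p q n (UniversalEnvelopingAlgebra.ι ℂ (Matrix.single a b 1 : 𝔤 p q)) =
      omegaUnit p q n a b := by
  rw [omegaG, UniversalEnvelopingAlgebra.lift_ι_apply, omegaLieG, glLieHom_single]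

theorem omegaUnit_inl_inr (i : Fin p) (j : Fin q) :
    omegaUnit p q n (Sum.inl i) (Sum.inr j) = mulOp (crossMat p q n i j) := by
  simp only [omegaUnit, crossMat, Matrix.smul_apply, Matrix.mul_apply, map_smul, map_sum, map_mul]
  rfl

theorem omegaUnit_inr_inl (i : Fin p) (j : Fin q) :
    omegaUnit p q n (Sum.inr j) (Sum.inl i) = diffOp (crossMat p q n i j) := by
  simp only [omegaUnit, crossMat, Matrix.smul_apply, Matrix.mul_apply, map_smul, map_sum, map_mul,
    varMat, Matrix.transpose_apply, Matrix.of_apply, diffOp_X]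
  rfl

theorem omegaG_pseudoSym_det_mul_det {d : ℕ} (i : Fin d → Fin p) (j : Fin d → Fin q) :
    omegaG p q n
        (pseudoSym p q (((Gmat p q).submatrix i j).det * ((Fmat p q).submatrix j i).det)) =
      mulOp ((crossMat p q n).submatrix i j).det * diffOp ((crossMat p q n).submatrix i j).det := by
  -- The `F`-matrix acts through the transpose of `crossMat`. The transposition is made among
  -- commuting polynomials, before `diffOp` is applied, since a column-determinant need not be
  -- invariant under it.
  rw [pseudoSym_det_mul_det, map_mul, map_colDet, map_colDet, ← colDet_eq_det, map_colDet,
    colDet_eq_det, ← Matrix.det_transpose, ← colDet_eq_det, map_colDet]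
  congr 2
  · ext1 a b
    simp only [Matrix.map_apply, Matrix.of_apply, omegaG_single, omegaUnit_inl_inr]
    rfl
  · ext1 a b
    simp only [Matrix.map_apply, Matrix.of_apply, omegaG_single, omegaUnit_inr_inl]
    rfl

theorem omegaG_pseudoSym_Xgen (d : ℕ) :
    omegaG p q n (pseudoSym p q (Xgen p q d)) = omegaM p q n (Cap p q n d) := by
  -- The `G`-minor and the `F`-minor each contribute `√-1 ^ d`; this is the sign in the Capelli
  -- element.
  have hI : Complex.I ^ d * Complex.I ^ d = (-1) ^ d := by
    rw [← mul_pow, Complex.I_mul_I]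
  have hL : omegaG p q n (pseudoSym p q (Xgen p q d)) =
      (-1 : ℂ) ^ d • ∑ I : Sub p d, ∑ J : Sub q d, ∑ S : Sub n d, ∑ T : Sub n d,
        (mulOp ((varMat (xvar p q n)).submatrix S.el I.el).det *
            diffOp ((varMat (xvar p q n)).submatrix T.el I.el).det) *
          (mulOp ((varMat (yvar p q n)).submatrix S.el J.el).det *
            diffOp ((varMat (yvar p q n)).submatrix T.el J.el).det) := by
    simp only [Xgen, map_sum, omegaG_pseudoSym_det_mul_det, det_crossMat_submatrix, map_smul,
      smul_mul_smul_comm, hI, Finset.smul_sum, Finset.sum_mul_sum]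
    refine Finset.sum_congr rfl fun I _ => Finset.sum_congr rfl fun J _ =>
      Finset.sum_congr rfl fun S _ => Finset.sum_congr rfl fun T _ => ?_
    rw [map_mul, map_mul, mul_assoc (mulOp _) (mulOp _), mul_assoc (mulOp _) (diffOp _),
      ← mul_assoc (diffOp _), diffOp_xdet_mul_mulOp_ydet, mul_assoc (mulOp _) (diffOp _)]
  have hR : omegaM p q n (Cap p q n d) =
      (-1 : ℂ) ^ d • ∑ S : Sub n d, ∑ T : Sub n d, ∑ I : Sub p d, ∑ J : Sub q d,
        (mulOp ((varMat (xvar p q n)).submatrix S.el I.el).det *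
            diffOp ((varMat (xvar p q n)).submatrix T.el I.el).det) *
          (mulOp ((varMat (yvar p q n)).submatrix S.el J.el).det *
            diffOp ((varMat (yvar p q n)).submatrix T.el J.el).det) := by
    simp only [Cap, map_mul, map_pow, map_neg, map_one, map_sum, omegaM_shiftedMinor_Ex,
      omegaM_shiftedMinor_Ey, Finset.sum_mul_sum]
    rw [Algebra.smul_def, map_pow, map_neg, map_one]
  rw [hL, hR]
  congr 1
  rw [Finset.sum_congr rfl fun I _ => Finset.sum_comm, Finset.sum_comm]
  refine Finset.sum_congr rfl fun S _ => ?_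
  rw [Finset.sum_congr rfl fun I _ => Finset.sum_comm, Finset.sum_comm]

theorem Sub.isEmpty_of_lt {k d : ℕ} (h : k < d) : IsEmpty (Sub k d) :=
  ⟨fun I => by
    have := Finset.card_le_univ I.1
    rw [I.2, Fintype.card_fin] at this
    omega⟩

theorem Cap_eq_zero {d : ℕ} (h : n < d) : Cap p q n d = 0 := by
  have := Sub.isEmpty_of_lt h
  simp [Cap]

/-! ### Antisymmetry of shifted minors in the column indices -/

section antisymmetry

variable {A ι : Type*} [Ring A] [Algebra ℂ A] [DecidableEq ι]

theorem eq_zero_of_eq_neg_self {M : Type*} [AddCommGroup M] [Module ℂ M] {x : M} (h : x = -x) :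
    x = 0 := by
  have h2 : (2 : ℂ) • x = 0 := by
    rw [two_smul]
    exact add_eq_zero_iff_eq_neg.2 h
  exact (smul_eq_zero.1 h2).resolve_left two_ne_zero

/-- The difference of the two sides is the sum of both commutators plus terms coming from the drop
`(m + 1) - m = 1` of the shifts, and these cancel. -/
theorem shifted_two_minor_symm {B : Type*} [Ring B] (P Q R S : B) (α β γ δ m : ℤ)
    (h1 : P * Q - Q * P = δ • R - γ • S) (h2 : R * S - S * R = β • P - α • Q) :
    (P + (α * (m + 1)) • 1) * (Q + (β * m) • 1) + (R + (γ * (m + 1)) • 1) * (S + (δ * m) • 1) =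
      (Q + (β * (m + 1)) • 1) * (P + (α * m) • 1) +
        (S + (δ * (m + 1)) • 1) * (R + (γ * m) • 1) := by
  rw [sub_eq_iff_eq_add] at h1 h2
  simp only [add_mul, mul_add, smul_mul_assoc, mul_smul_comm, one_mul, mul_one, h1, h2]
  module

variable (E : ι → ι → A) (hE : ∀ a b c e, E a b * E c e - E c e * E a b =
  (if b = c then E a e else 0) - (if a = e then E c b else 0))

include hE in
-- In the sum of the two determinants, the first two columns contribute a quadratic expression
-- symmetric in the two row indices (`hQ`). Its alternating sum equals its own negative, hence is
-- zero.
theorem colDet_shiftedMat_swap_zero_one {d : ℕ} (s t : Fin (d + 2) → ι) :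
    colDet (shiftedMat E s (t ∘ Equiv.swap 0 1)) = -colDet (shiftedMat E s t) := by
  set Z := shiftedMat E s t with hZ
  set Z' := shiftedMat E s (t ∘ Equiv.swap 0 1) with hZ'
  have hrest : ∀ (a : Fin (d + 2)) (b : Fin d), Z' a b.succ.succ = Z a b.succ.succ := by
    intro a b
    have : Equiv.swap (0 : Fin (d + 2)) 1 b.succ.succ = b.succ.succ :=
      Equiv.swap_apply_of_ne_of_ne (Fin.succ_ne_zero _)
        (by rw [← Fin.succ_zero_eq_one]; exact fun h => Fin.succ_ne_zero b (Fin.succ_injective _ h))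
    simp [hZ, hZ', shiftedMat, this]
  have hexp : ∀ W : Matrix (Fin (d + 2)) (Fin (d + 2)) A, colDet W =
      ∑ σ : Equiv.Perm (Fin (d + 2)), (Equiv.Perm.sign σ : ℤ) • (W (σ 0) 0 * W (σ 1) 1 *
        (List.ofFn fun b : Fin d => W (σ b.succ.succ) b.succ.succ).prod) := by
    intro W
    simp [colDet, List.ofFn_succ, mul_assoc]
  have hQ : ∀ a b, Z a 0 * Z b 1 + Z' a 0 * Z' b 1 = Z b 0 * Z a 1 + Z' b 0 * Z' a 1 := by
    intro a b
    have hc : ∀ (P : Prop) [Decidable P] (k : ℤ), (if P then (k : A) else 0) =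
        ((if P then 1 else 0) * k : ℤ) • (1 : A) := by
      intro P _ k; split_ifs <;> simp
    have hi : ∀ (P : Prop) [Decidable P] (x : A), (if P then x else 0) =
        (if P then 1 else 0 : ℤ) • x := by
      intro P _ x; split_ifs <;> simp
    have h := shifted_two_minor_symm (E (s a) (t 0)) (E (s b) (t 1)) (E (s a) (t 1)) (E (s b) (t 0))
      (if s a = t 0 then 1 else 0) (if s b = t 1 then 1 else 0) (if s a = t 1 then 1 else 0)
      (if s b = t 0 then 1 else 0) d
      (by rw [hE, hi, hi]; simp only [eq_comm])
      (by rw [hE, hi, hi]; simp only [eq_comm])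
    have e0 : (((d + 2 : ℕ) : ℤ) - (((0 : Fin (d + 2)) : ℕ) + 1)) = (d : ℤ) + 1 := by
      push_cast [Fin.val_zero]; ring
    have e1 : (((d + 2 : ℕ) : ℤ) - (((1 : Fin (d + 2)) : ℕ) + 1)) = (d : ℤ) := by
      push_cast [Fin.val_one]; ring
    simp only [hZ, hZ', shiftedMat, Matrix.of_apply, Function.comp_apply, Equiv.swap_apply_left,
      Equiv.swap_apply_right, e0, e1, hc]
    rw [h, add_comm]
  have hsum : colDet Z' + colDet Z = 0 := by
    have hS : colDet Z' + colDet Z = ∑ σ : Equiv.Perm (Fin (d + 2)), (Equiv.Perm.sign σ : ℤ) •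
        ((Z (σ 0) 0 * Z (σ 1) 1 + Z' (σ 0) 0 * Z' (σ 1) 1) *
          (List.ofFn fun b : Fin d => Z (σ b.succ.succ) b.succ.succ).prod) := by
      rw [hexp, hexp, ← Finset.sum_add_distrib]
      refine Finset.sum_congr rfl fun σ _ => ?_
      simp only [hrest]
      rw [← smul_add, ← add_mul, add_comm (Z' (σ 0) 0 * Z' (σ 1) 1)]
    apply eq_zero_of_eq_neg_self
    conv_lhs => rw [hS]
    rw [hS, ← Finset.sum_neg_distrib]
    refine Fintype.sum_equiv (Equiv.mulRight (Equiv.swap 0 1)) _ _ fun σ => ?_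
    have hfix : ∀ b : Fin d, Equiv.swap (0 : Fin (d + 2)) 1 b.succ.succ = b.succ.succ := fun b =>
      Equiv.swap_apply_of_ne_of_ne (Fin.succ_ne_zero _)
        (by rw [← Fin.succ_zero_eq_one]; exact fun h => Fin.succ_ne_zero b (Fin.succ_injective _ h))
    simp only [Equiv.coe_mulRight, Equiv.Perm.mul_apply, Equiv.swap_apply_left,
      Equiv.swap_apply_right, hfix, Equiv.Perm.sign_mul, Equiv.Perm.sign_swap
        (zero_ne_one : (0 : Fin (d + 2)) ≠ 1), hQ (σ 1) (σ 0)]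
    simp
  exact eq_neg_of_add_eq_zero_left hsum

include hE in
theorem colDet_shiftedMat_swap {d : ℕ} (i : Fin d) (s t : Fin (d + 1) → ι) :
    colDet (shiftedMat E s (t ∘ Equiv.swap i.castSucc i.succ)) = -colDet (shiftedMat E s t) := by
  induction d with
  | zero => exact i.elim0
  | succ d ih =>
    refine Fin.cases ?_ (fun j => ?_) i
    · exact colDet_shiftedMat_swap_zero_one E hE s t
    -- A swap away from the first column passes to the smaller determinants of the expansion.
    · rw [colDet_shiftedMat_succ, colDet_shiftedMat_succ, ← Finset.sum_neg_distrib]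
      refine Finset.sum_congr rfl fun a _ => ?_
      have h0 : Equiv.swap j.succ.castSucc j.succ.succ 0 = 0 :=
        Equiv.swap_apply_of_ne_of_ne (by rw [← Fin.succ_castSucc]; exact (Fin.succ_ne_zero _).symm)
          (Fin.succ_ne_zero _).symm
      have h1 : (t ∘ Equiv.swap j.succ.castSucc j.succ.succ) ∘ Fin.succ =
          (t ∘ Fin.succ) ∘ Equiv.swap j.castSucc j.succ := by
        funext b
        simp only [Function.comp_apply]
        rw [← Fin.succ_castSucc, ← (Fin.succ_injective (d + 1)).swap_apply]
      rw [h1, ih, Function.comp_apply, h0, mul_neg, smul_neg]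

include hE in
theorem colDet_shiftedMat_comp_right {d : ℕ} (s t : Fin d → ι) (τ : Equiv.Perm (Fin d)) :
    colDet (shiftedMat E s (t ∘ τ)) = (Equiv.Perm.sign τ : ℤ) • colDet (shiftedMat E s t) := by
  cases d with
  | zero => simp [Subsingleton.elim τ 1]
  | succ d =>
    -- Adjacent transpositions generate the symmetric group.
    have hτ : τ ∈ Submonoid.closure
        (Set.range fun i : Fin d => Equiv.swap i.castSucc i.succ) := by
      rw [Equiv.Perm.mclosure_swap_castSucc_succ]; trivial
    induction hτ using Submonoid.closure_induction generalizing t with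
    | mem x hx =>
      obtain ⟨i, rfl⟩ := hx
      simp only []
      rw [colDet_shiftedMat_swap E hE, Equiv.Perm.sign_swap (Fin.castSucc_lt_succ).ne]
      simp
    | one => simp
    | mul x y _ _ hx hy =>
      rw [Equiv.Perm.coe_mul, ← Function.comp_assoc, hy, hx, smul_smul, Equiv.Perm.sign_mul,
        Units.val_mul, mul_comm]

theorem colDet_shiftedMat_eq_zero_left {d : ℕ} (s t : Fin d → ι) (hs : ¬ Function.Injective s) :
    colDet (shiftedMat E s t) = 0 := by
  simp only [Function.Injective, not_forall] at hs
  obtain ⟨a, b, hab, hne⟩ := hs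
  apply eq_zero_of_eq_neg_self
  -- Swapping two equal indices does not change `s` but changes the sign.
  have h := colDet_shiftedMat_comp_left E s t (Equiv.swap a b)
  rw [Equiv.comp_swap_eq_update, hab, Function.update_eq_self, ← hab, Function.update_eq_self,
    Equiv.Perm.sign_swap hne] at h
  simpa using h

include hE in
theorem colDet_shiftedMat_eq_zero_right {d : ℕ} (s t : Fin d → ι) (ht : ¬ Function.Injective t) :
    colDet (shiftedMat E s t) = 0 := by
  simp only [Function.Injective, not_forall] at ht
  obtain ⟨a, b, hab, hne⟩ := ht
  apply eq_zero_of_eq_neg_self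
  have h := colDet_shiftedMat_comp_right E hE s t (Equiv.swap a b)
  rw [Equiv.comp_swap_eq_update, hab, Function.update_eq_self, ← hab, Function.update_eq_self,
    Equiv.Perm.sign_swap hne] at h
  simpa using h

end antisymmetry

/-- Each factor alternates in `s` and in `t`, so the product is symmetric and vanishes on repeated
indices. Sums over all sequences, unlike those over subsets, are adapted to the action of `GL_n`. -/
theorem sum_colDet_mul_colDet {A : Type*} [Ring A] [Algebra ℂ A] {n d : ℕ}
    (E E' : Fin n → Fin n → A)
    (hE : ∀ a b c e, E a b * E c e - E c e * E a b =
      (if b = c then E a e else 0) - (if a = e then E c b else 0))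
    (hE' : ∀ a b c e, E' a b * E' c e - E' c e * E' a b =
      (if b = c then E' a e else 0) - (if a = e then E' c b else 0)) :
    ∑ s : Fin d → Fin n, ∑ t : Fin d → Fin n,
        colDet (shiftedMat E s t) * colDet (shiftedMat E' s t) =
      d.factorial • d.factorial • ∑ S : Sub n d, ∑ T : Sub n d,
        colDet (shiftedMat E S.el T.el) * colDet (shiftedMat E' S.el T.el) := by
  have hsgn : ∀ (τ : Equiv.Perm (Fin d)) (u v : A),
      ((Equiv.Perm.sign τ : ℤ) • u) * ((Equiv.Perm.sign τ : ℤ) • v) = u * v := by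
    intro τ u v
    rw [smul_mul_smul_comm, ← Units.val_mul, Int.units_mul_self, Units.val_one, one_smul]
  rw [sum_fun_eq_factorial_smul (fun s => ∑ t, colDet (shiftedMat E s t) *
    colDet (shiftedMat E' s t))]
  · congr 1
    rw [Finset.smul_sum]
    refine Finset.sum_congr rfl fun S _ => ?_
    apply sum_fun_eq_factorial_smul
    · intro t ht
      rw [colDet_shiftedMat_eq_zero_right E hE _ _ ht, zero_mul]
    · intro t τ
      rw [colDet_shiftedMat_comp_right E hE, colDet_shiftedMat_comp_right E' hE', hsgn]
  · intro s hs
    simp [colDet_shiftedMat_eq_zero_left E s _ hs]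
  · intro s τ
    simp only [colDet_shiftedMat_comp_left, hsgn]

/-! ### Transformation of shifted minors under the general linear group -/

section transformation

variable {A : Type*} [Ring A]

theorem list_prod_ofFn_sum {X : Type*} [Fintype X] {d : ℕ} (f : Fin d → X → A) :
    (List.ofFn fun b => ∑ x, f b x).prod =
      ∑ x : Fin d → X, (List.ofFn fun b => f b (x b)).prod := by
  induction d with
  | zero => simp
  | succ d ih =>
    rw [← (Fin.consEquiv fun _ => X).sum_comp, Fintype.sum_prod_type]
    simp only [List.ofFn_succ, List.prod_cons, ih, Finset.sum_mul_sum]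
    rfl

variable [Algebra ℂ A]

theorem list_prod_ofFn_smul {d : ℕ} (c : Fin d → ℂ) (f : Fin d → A) :
    (List.ofFn fun b => c b • f b).prod = (∏ b, c b) • (List.ofFn f).prod := by
  induction d with
  | zero => simp
  | succ d ih =>
    rw [List.ofFn_succ, List.prod_cons, ih, List.ofFn_succ, List.prod_cons, Fin.prod_univ_succ,
      smul_mul_smul_comm]

variable {ι : Type*} [Fintype ι] [DecidableEq ι]

/-- The `d`-th tensor power of a square matrix. -/
def tensorPowMat (d : ℕ) (g : Matrix ι ι ℂ) : Matrix (Fin d → ι) (Fin d → ι) ℂ :=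
  Matrix.of fun s t => ∏ b, g (s b) (t b)

theorem tensorPowMat_mul_eq_one (d : ℕ) {g h : Matrix ι ι ℂ} (hgh : g * h = 1) :
    tensorPowMat d g * tensorPowMat d h = 1 := by
  ext s t
  have h1 : (tensorPowMat d g * tensorPowMat d h) s t = ∏ b, (g * h) (s b) (t b) := by
    simp only [Matrix.mul_apply, tensorPowMat, Matrix.of_apply, ← Finset.prod_mul_distrib]
    rw [Finset.prod_univ_sum, Fintype.piFinset_univ]
  rw [h1, hgh]
  by_cases hst : s = t
  · subst hst; simp
  · obtain ⟨b, hb⟩ := Function.ne_iff.1 hst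
    rw [Matrix.one_apply_ne hst]
    exact Finset.prod_eq_zero (Finset.mem_univ b) (Matrix.one_apply_ne hb)

/-- Since `h * g = 1`, the Kronecker delta transforms like `E`, so the shifted entries do too and
the determinant can be expanded multilinearly. -/
theorem map_colDet_shiftedMat_of_conj (φ : A →ₐ[ℂ] A) (E : ι → ι → A) {g h : Matrix ι ι ℂ}
    (hhg : h * g = 1) (hφ : ∀ s t, φ (E s t) = ∑ a, ∑ b, (g a s * h t b) • E a b) {d : ℕ}
    (s t : Fin d → ι) :
    φ (colDet (shiftedMat E s t)) = ∑ s', ∑ t',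
      (tensorPowMat d g s' s * tensorPowMat d h t t') • colDet (shiftedMat E s' t') := by
  rw [map_colDet_shiftedMat]
  have h1 : ∀ a b, shiftedMat (fun a b => φ (E a b)) s t a b =
      ∑ k, ∑ l, (g k (s a) * h (t b) l) • (E k l +
        if k = l then (((d : ℤ) - ((b : ℕ) + 1) : ℤ) : A) else 0) := by
    intro a b
    have hone : ∑ k, g k (s a) * h (t b) k = if s a = t b then 1 else 0 := by
      have := congrFun (congrFun hhg (t b)) (s a)
      rw [Matrix.mul_apply, Matrix.one_apply] at this
      simpa only [mul_comm, eq_comm] using this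
    simp only [shiftedMat, Matrix.of_apply, hφ, smul_add, Finset.sum_add_distrib, smul_ite,
      smul_zero, Finset.sum_ite_eq, Finset.mem_univ, if_true, ← Finset.sum_smul, hone]
    split_ifs <;> simp
  have h2 : ∀ σ : Equiv.Perm (Fin d),
      (List.ofFn fun b => shiftedMat (fun a b => φ (E a b)) s t (σ b) b).prod =
      ∑ s', ∑ t', (tensorPowMat d g s' s * tensorPowMat d h t t') •
        (List.ofFn fun b => shiftedMat E s' t' (σ b) b).prod := by
    intro σ
    simp only [h1, list_prod_ofFn_sum, list_prod_ofFn_smul]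
    -- The factor in column `b` carries row index `s (σ b)`; the row summation variables are
    -- relabelled by `σ` so that the coefficient no longer depends on `σ`.
    refine Fintype.sum_equiv (σ.arrowCongr (Equiv.refl ι)) _ _ fun s' => ?_
    refine Finset.sum_congr rfl fun t' _ => ?_
    rw [Finset.prod_mul_distrib]
    congr 2
    · rw [tensorPowMat, Matrix.of_apply]
      conv_rhs => rw [← Equiv.prod_comp σ]
      simp
    · simp [shiftedMat]
  simp only [colDet, h2, Finset.smul_sum]
  rw [Finset.sum_comm]
  refine Finset.sum_congr rfl fun s' _ => ?_
  rw [Finset.sum_comm]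
  refine Finset.sum_congr rfl fun t' _ => Finset.sum_congr rfl fun σ _ => ?_
  rw [smul_comm]

theorem map_sum_mul_of_contragredient {W : Type*} [Fintype W] [DecidableEq W] (φ : A →ₐ[ℂ] A)
    (u v : W → A) {M M' : Matrix W W ℂ} (hM : M * M' = 1) (hu : ∀ w, φ (u w) = ∑ a, M a w • u a)
    (hv : ∀ w, φ (v w) = ∑ b, M' w b • v b) : φ (∑ w, u w * v w) = ∑ w, u w * v w := by
  simp only [map_sum, map_mul, hu, hv, Finset.sum_mul_sum, smul_mul_smul_comm]
  rw [Finset.sum_comm]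
  refine Finset.sum_congr rfl fun a _ => ?_
  rw [Finset.sum_comm]
  simp only [← Finset.sum_smul, ← Matrix.mul_apply, hM, Matrix.one_apply, ite_smul, one_smul,
    zero_smul, Finset.sum_ite_eq, Finset.mem_univ, if_true]

theorem map_sum_colDet_mul_colDet (φ : A →ₐ[ℂ] A) (E E' : ι → ι → A) {g h : Matrix ι ι ℂ}
    (hhg : h * g = 1) (hφ : ∀ s t, φ (E s t) = ∑ a, ∑ b, (g a s * h t b) • E a b)
    (hφ' : ∀ s t, φ (E' s t) = ∑ a, ∑ b, (h s a * g b t) • E' a b) (d : ℕ) :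
    φ (∑ s : Fin d → ι, ∑ t : Fin d → ι,
        colDet (shiftedMat E s t) * colDet (shiftedMat E' s t)) =
      ∑ s : Fin d → ι, ∑ t : Fin d → ι,
        colDet (shiftedMat E s t) * colDet (shiftedMat E' s t) := by
  have hgh : g * h = 1 := mul_eq_one_comm.1 hhg
  have hT : g.transpose * h.transpose = 1 := by
    rw [← Matrix.transpose_mul, hhg, Matrix.transpose_one]
  have hK : (tensorPowMat d h).transpose * (tensorPowMat d g).transpose = 1 := by
    rw [← Matrix.transpose_mul, tensorPowMat_mul_eq_one d hgh, Matrix.transpose_one]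
  simp only [← Fintype.sum_prod_type' (f := fun s t : Fin d → ι =>
    colDet (shiftedMat E s t) * colDet (shiftedMat E' s t))]
  refine map_sum_mul_of_contragredient φ (fun w : (Fin d → ι) × (Fin d → ι) =>
      colDet (shiftedMat E w.1 w.2)) (fun w => colDet (shiftedMat E' w.1 w.2))
    -- Pairs `(s, t)` index a vector: the row index transforms by `g^{⊗d}` and the column index by
    -- the transpose of `h^{⊗d}`. For `E'` the roles of `g` and `h` are exchanged, giving the
    -- inverse matrix.
    (M := Matrix.kronecker (tensorPowMat d g) (tensorPowMat d h).transpose)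
    (M' := Matrix.kronecker (tensorPowMat d h) (tensorPowMat d g).transpose) ?_ ?_ ?_
  · change Matrix.kroneckerMap (fun x y => x * y) _ _ *
      Matrix.kroneckerMap (fun x y => x * y) _ _ = 1
    rw [← Matrix.mul_kronecker_mul, tensorPowMat_mul_eq_one d hgh, hK, Matrix.one_kronecker_one]
  · rintro ⟨s, t⟩
    rw [map_colDet_shiftedMat_of_conj φ E hhg hφ, Fintype.sum_prod_type]
    rfl
  · rintro ⟨s, t⟩
    rw [map_colDet_shiftedMat_of_conj φ E' hT hφ', Fintype.sum_prod_type]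
    rfl

end transformation

/-! ### Invariance of the Capelli elements -/

theorem shift_rel {A ι : Type*} [Ring A] [Algebra ℂ A] [DecidableEq ι] (E : ι → ι → A) (r : ℂ)
    (hE : ∀ a b c e, E a b * E c e - E c e * E a b =
      (if b = c then E a e else 0) - (if a = e then E c b else 0)) (a b c e : ι) :
    (E a b - if a = b then algebraMap ℂ A r else 0) *
          (E c e - if c = e then algebraMap ℂ A r else 0) -
        (E c e - if c = e then algebraMap ℂ A r else 0) *
          (E a b - if a = b then algebraMap ℂ A r else 0) =
      (if b = c then E a e - (if a = e then algebraMap ℂ A r else 0) else 0) -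
        (if a = e then E c b - (if c = b then algebraMap ℂ A r else 0) else 0) := by
  have hc : ∀ (P : Prop) [Decidable P] (x : A),
      (if P then algebraMap ℂ A r else 0) * x = x * (if P then algebraMap ℂ A r else 0) := by
    intro P _ x
    split_ifs
    · exact Algebra.commutes r x
    · simp
  have h : ∀ P Q x y : A, x * Q = Q * x → y * P = P * y → x * y = y * x →
      (P - x) * (Q - y) - (Q - y) * (P - x) = P * Q - Q * P := by
    intro P Q x y h1 h2 h3
    simp only [sub_mul, mul_sub, h1, h2, h3]
    abel
  rw [h _ _ _ _ (hc _ _) (hc _ _) (hc _ _), hE]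
  by_cases hbc : b = c <;> by_cases hae : a = e
  · subst hbc hae; simp
  · subst hbc; simp [hae]
  · subst hae; simp [hbc, Ne.symm hbc]
  · simp [hbc, hae]

theorem shift_conj {A ι : Type*} [Ring A] [Algebra ℂ A] [Fintype ι] [DecidableEq ι]
    (φ : A →ₐ[ℂ] A) (E : ι → ι → A) (r : ℂ) {g h : Matrix ι ι ℂ} (hhg : h * g = 1)
    (hφ : ∀ s t, φ (E s t) = ∑ a, ∑ b, (g a s * h t b) • E a b) (s t : ι) :
    φ (E s t - if s = t then algebraMap ℂ A r else 0) =
      ∑ a, ∑ b, (g a s * h t b) • (E a b - if a = b then algebraMap ℂ A r else 0) := by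
  have hone : ∑ k, g k s * h t k = if s = t then 1 else 0 := by
    have := congrFun (congrFun hhg t) s
    rw [Matrix.mul_apply, Matrix.one_apply] at this
    simpa only [mul_comm, eq_comm] using this
  simp only [map_sub, hφ, smul_sub, Finset.sum_sub_distrib, smul_ite, smul_zero,
    Finset.sum_ite_eq, Finset.mem_univ, if_true, ← Finset.sum_smul, hone, apply_ite φ, map_zero,
    AlgHom.commutes]
  split_ifs <;> simp

theorem single_bracket {ι : Type*} [Fintype ι] [DecidableEq ι] (a b c e : ι) :
    (Matrix.single a b 1 * Matrix.single c e 1 - Matrix.single c e 1 * Matrix.single a b 1 :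
      Matrix ι ι ℂ) =
      (if b = c then Matrix.single a e 1 else 0) - (if a = e then Matrix.single c b 1 else 0) := by
  by_cases hbc : b = c <;> by_cases hae : a = e
  · subst hbc hae; simp
  · subst hbc; simp [hae, Ne.symm hae]
  · subst hae; simp [hbc]
  · simp [hbc, hae, Ne.symm hae]

theorem Ex_rel (n : ℕ) (a b c e : Fin n) : Ex n a b * Ex n c e - Ex n c e * Ex n a b =
    (if b = c then Ex n a e else 0) - (if a = e then Ex n c b else 0) := by
  let f : Matrix (Fin n) (Fin n) ℂ →ₗ[ℂ] Um n :=
    (UniversalEnvelopingAlgebra.ι ℂ : 𝔪 n →ₗ⁅ℂ⁆ Um n).toLinearMap ∘ₗ LinearMap.inl ℂ _ _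
  have h : Ex n a b * Ex n c e - Ex n c e * Ex n a b = f (Matrix.single a b 1 *
      Matrix.single c e 1 - Matrix.single c e 1 * Matrix.single a b 1) := by
    rw [← LieRing.of_associative_ring_bracket, Ex, Ex, ← LieHom.map_lie]
    change _ = UniversalEnvelopingAlgebra.ι ℂ _
    congr 1
    refine Prod.ext rfl ?_
    change (0 : Matrix (Fin n) (Fin n) ℂ) * 0 - 0 * 0 = 0
    simp
  rw [h, single_bracket, map_sub, apply_ite f, apply_ite f, map_zero]
  rfl

theorem Ey_rel (n : ℕ) (a b c e : Fin n) : Ey n a b * Ey n c e - Ey n c e * Ey n a b =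
    (if b = c then Ey n a e else 0) - (if a = e then Ey n c b else 0) := by
  let f : Matrix (Fin n) (Fin n) ℂ →ₗ[ℂ] Um n :=
    (UniversalEnvelopingAlgebra.ι ℂ : 𝔪 n →ₗ⁅ℂ⁆ Um n).toLinearMap ∘ₗ LinearMap.inr ℂ _ _
  have h : Ey n a b * Ey n c e - Ey n c e * Ey n a b = f (Matrix.single a b 1 *
      Matrix.single c e 1 - Matrix.single c e 1 * Matrix.single a b 1) := by
    rw [← LieRing.of_associative_ring_bracket, Ey, Ey, ← LieHom.map_lie]
    change _ = UniversalEnvelopingAlgebra.ι ℂ _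
    congr 1
    refine Prod.ext ?_ rfl
    change (0 : Matrix (Fin n) (Fin n) ℂ) * 0 - 0 * 0 = 0
    simp
  rw [h, single_bracket, map_sub, apply_ite f, apply_ite f, map_zero]
  rfl

theorem conj_single {ι : Type*} [Fintype ι] [DecidableEq ι] (g h : Matrix ι ι ℂ) (s t : ι) :
    g * Matrix.single s t 1 * h = ∑ a, ∑ b, (g a s * h t b) • Matrix.single a b (1 : ℂ) := by
  rw [Matrix.matrix_eq_sum_single (g * Matrix.single s t 1 * h)]
  refine Finset.sum_congr rfl fun a _ => Finset.sum_congr rfl fun b _ => ?_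
  rw [Matrix.smul_single, smul_eq_mul, mul_one]
  congr 1
  simp [Matrix.mul_apply, Matrix.single_apply, Finset.sum_ite_eq, ite_and]

/-- The adjoint action of an element of `H` on `U(𝔪)`. -/
def adU {n : ℕ} (g : Matrix.GeneralLinearGroup (Fin n) ℂ) : Um n →ₐ[ℂ] Um n :=
  UniversalEnvelopingAlgebra.lift ℂ
    ((UniversalEnvelopingAlgebra.ι ℂ : 𝔪 n →ₗ⁅ℂ⁆ Um n).comp (AdH g))

theorem adU_Ex {n : ℕ} (g : Matrix.GeneralLinearGroup (Fin n) ℂ) (s t : Fin n) :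
    adU g (Ex n s t) = ∑ a, ∑ b, (g.1 a s * g⁻¹.1 t b) • Ex n a b := by
  let f : Matrix (Fin n) (Fin n) ℂ →ₗ[ℂ] Um n :=
    (UniversalEnvelopingAlgebra.ι ℂ : 𝔪 n →ₗ⁅ℂ⁆ Um n).toLinearMap ∘ₗ LinearMap.inl ℂ _ _
  have h : adU g (Ex n s t) = f (g.1 * Matrix.single s t 1 * g⁻¹.1) := by
    rw [adU, Ex, UniversalEnvelopingAlgebra.lift_ι_apply]
    change UniversalEnvelopingAlgebra.ι ℂ _ = UniversalEnvelopingAlgebra.ι ℂ _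
    congr 1
    refine Prod.ext rfl ?_
    change (g⁻¹.1).transpose * 0 * (g.1).transpose = 0
    simp
  rw [h, conj_single]
  simp only [map_sum, map_smul]
  rfl

theorem adU_Ey {n : ℕ} (g : Matrix.GeneralLinearGroup (Fin n) ℂ) (s t : Fin n) :
    adU g (Ey n s t) =
      ∑ a, ∑ b, ((g⁻¹.1).transpose a s * (g.1).transpose t b) • Ey n a b := by
  let f : Matrix (Fin n) (Fin n) ℂ →ₗ[ℂ] Um n :=
    (UniversalEnvelopingAlgebra.ι ℂ : 𝔪 n →ₗ⁅ℂ⁆ Um n).toLinearMap ∘ₗ LinearMap.inr ℂ _ _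
  have h : adU g (Ey n s t) =
      f ((g⁻¹.1).transpose * Matrix.single s t 1 * (g.1).transpose) := by
    rw [adU, Ey, UniversalEnvelopingAlgebra.lift_ι_apply]
    change UniversalEnvelopingAlgebra.ι ℂ _ = UniversalEnvelopingAlgebra.ι ℂ _
    congr 1
    refine Prod.ext ?_ rfl
    change g.1 * 0 * g⁻¹.1 = 0
    simp
  rw [h, conj_single]
  simp only [map_sum, map_smul]
  rfl

theorem Cap_mem_UmH (p q n d : ℕ) : Cap p q n d ∈ UmH n := by
  rw [UmH, Submodule.mem_iInf]
  intro g
  rw [LinearMap.mem_eqLocus]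
  change adU g (Cap p q n d) = Cap p q n d
  have hinv : g⁻¹.1 * g.1 = 1 := g.inv_mul
  have hinvT : (g.1).transpose * (g⁻¹.1).transpose = 1 := by
    rw [← Matrix.transpose_mul, hinv, Matrix.transpose_one]
  simp only [Cap, map_mul, map_pow, map_neg, map_one, shiftedMinor_eq]
  congr 1
  have hsum := sum_colDet_mul_colDet (d := d) _ _ (shift_rel (Ex n) ((p : ℂ) / 2) (Ex_rel n))
    (shift_rel (Ey n) ((q : ℂ) / 2) (Ey_rel n))
  have hmap := map_sum_colDet_mul_colDet (adU g) _ _ hinv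
    (shift_conj (adU g) (Ex n) ((p : ℂ) / 2) hinv (adU_Ex g))
    (shift_conj (adU g) (Ey n) ((q : ℂ) / 2) hinvT (adU_Ey g)) d
  rw [hsum, map_nsmul, map_nsmul] at hmap
  have hd : ((d.factorial : ℕ) : ℂ) ≠ 0 := Nat.cast_ne_zero.2 d.factorial_ne_zero
  simp only [← Nat.cast_smul_eq_nsmul ℂ] at hmap
  -- Both factors `d!` are cancelled, which returns from sequences to subsets.
  exact smul_right_injective _ hd (smul_right_injective _ hd hmap)

end CapelliC

theorem mainTheorem2 (p q n : ℕ) :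
    (∀ d : ℕ, 1 ≤ d → d ≤ min p (min q n) →
      CapelliC.omegaG p q n (CapelliC.pseudoSym p q (CapelliC.Xgen p q d)) =
        CapelliC.omegaM p q n (CapelliC.Cap p q n d)) ∧
    (∀ d : ℕ, 1 ≤ d → d ≤ n → CapelliC.Cap p q n d ∈ CapelliC.UmH n) ∧
    (∀ d : ℕ, n < d → d ≤ min p q →
      CapelliC.omegaG p q n (CapelliC.pseudoSym p q (CapelliC.Xgen p q d)) = 0 ∧
        CapelliC.Cap p q n d = 0) := by
  refine ⟨fun d _ _ => CapelliC.omegaG_pseudoSym_Xgen p q n d,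
    fun d _ _ => CapelliC.Cap_mem_UmH p q n d, fun d h _ => ?_⟩
  have h0 := CapelliC.Cap_eq_zero p q n h
  exact ⟨by rw [CapelliC.omegaG_pseudoSym_Xgen, h0, map_zero], h0⟩

end
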